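/- **Setting.** A server holds $N$ files of $B$ independent uniform bits each. It is connected by $H$ error-free links to relays $1,\dots,H$; there are $K=\binom{H}{r}$ users, one for each $r$-subset of the relays, and user $k$ is connected by error-free links to the relays in its subset $\mathcal H_k$. *Uncoded placement:* before the demands are known, each user copies at most $MB$ of the $NB$ library bits into its cache, $M\in[0,N]$. *Delivery:* given the placement and the demands $\mathbf d=(d_k)\in[N]^K$ (known to all nodes), the server sends to each relay $h$ a message that is a function of the files, each relay $h$ sends to each user $k$ with $h\in\mathcal H_k$ a function of what it received, and user $k$ decodes file $F_{d_k}$ from its cache and what it received. The max-link load is the largest number of bits on a link divided by $B$. A load $R$ is achievable at $M$ if for every $\varepsilon>0$ there are a file size $B\ge 1$ and an uncoded placement such that, for all demands, there is a delivery of max-link load at most $R$ for which each user errs with probability at most $\varepsilon$. $R^\star_{\mathrm u}(M)$ is the infimum of the achievable loads. **Scheme.** Let $M=tN/K$ with $t\in\{0,\dots,K\}$. Each file $F_i$ is split into $\binom Kt$ equal sub-files $F_{i,\mathcal W}$, $\mathcal W\subseteq[K]$, $|\mathcal W|=t$; user $k$ caches $F_{i,\mathcal W}$ iff $k\in\mathcal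 W$. For $\mathcal J\subseteq[K]$ with $|\mathcal J|=t+1$ let $W_{\mathcal J}=\bigoplus_{j\in\mathcal J}F_{d_j,\mathcal J\setminus\{j\}}$ and let $\mathcal R_{\mathcal J}$ be the set of relays connected to all users in $\mathcal J$. If $\mathcal R_{\mathcal J}\ne\emptyset$, then $W_{\mathcal J}$ is divided into $|\mathcal R_{\mathcal J}|$ equal pieces, one sent to each relay in $\mathcal R_{\mathcal J}$. If $\mathcal R_{\mathcal J}=\emptyset$, each relay connected to at least one user of $\mathcal J$ is sent $B/\big(r\binom Kt\big)$ bits formed by random linear combinations of $W_{\mathcal J}$, where $W_{\mathcal J}$ is read as a vector over $\mathbb F_{2^m}$ of a fixed length $n$ (divisible by $r!$, so that all divisions are exact), the coefficients are independent and uniform in $\mathbb F_{2^m}$, and $m\to\infty$. Relays forward what they receive. **Uncoded cut-set bound.** For $x\in\{r,\dots,H\}$ let $c_x:[0,N]\to\mathbb R$ be the piecewise linear curve through the points $\Big(t\,N/\binom xr,\ \frac{\binom xr-t}{x(t+1)}\Big)$, $t=0,\dots,\binom xr$; the bound at $M$ is $\max_{r\le x\le H}c_x(M)$. **Theorem.**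 Let $r\ge1$, $r=H-1$ (so that $K=H$) and $N\ge K$. Then the scheme is optimal under uncoded placement. Precisely, there are numbers $\rho_0,\dots,\rho_K$ such that: 1. for every $t\in\{0,\dots,K\}$ the scheme at $M=tN/K$ fills each cache with exactly $MB$ bits, has max-link load exactly $\rho_t$ for all demands, and, with probability tending to $1$ as $m\to\infty$ over the random coefficients, lets all users recover their files without error for all demands; 2. $\rho_t=\frac{K-t}{(t+1)H}$ for $0\le t\le K-2$, $\rho_{K-1}=\frac1{rK}$ and $\rho_K=0$; 3. for every $t\in\{0,\dots,K\}$, $\rho_t=R^\star_{\mathrm u}(tN/K)$, and this is the value of the uncoded cut-set bound at $tN/K$; for $t\le K-2$ it is the value of the curve $c_H$ at $tN/K$; 4. for every $M\in[0,N]$, $R^\star_{\mathrm u}(M)$ equals the value at $M$ of the lower convex hull of the points $(tN/K,\rho_t)$, $t=0,\dots,K$ (memory sharing between the operating points of the scheme), and equals the value of the uncoded cut-set bound at $M$. -/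

import Mathlib

open scoped Nat

noncomputable section

namespace CombNet

/-- The users of the combination network with `H` relays: one user for every set of `r` relays.
The set of relays connected to the user `k` is `k.1`; there are `H.choose r` users. -/
abbrev User (H r : ℕ) : Type := {S : Finset (Fin H) // S.card = r}

/-- The users connected to relay `h`. -/
def usersOf {H r : ℕ} (h : Fin H) : Finset (User H r) :=
  Finset.univ.filter fun k => h ∈ k.1

/-- A library of `N` files; the bit positions of a file are indexed by the type `β`, so that
the file size is `B = Nat.card β` bits. -/
abbrev Files (N : ℕ) (β : Type) : Type := Fin N → β → ZMod 2

/-- An uncoded placement: for each user, the set of library bits (file, position) that are copied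
into its cache. -/
abbrev Placement (H r N : ℕ) (β : Type) : Type := User H r → Finset (Fin N × β)

/-- What user `k` finds in its cache under an uncoded placement. -/
def cacheContent {H r N : ℕ} {β : Type} (Z : Placement H r N β) (k : User H r)
    (F : Files N β) : Z k → ZMod 2 :=
  fun x => F x.1.1 x.1.2

/-- The encoding maps of a delivery phase (for a given placement and a given demand vector).
The server sends relay `h` a message with bits indexed by the finite type `relayIdx h`; relay `h`
sends to each of its users `k` a message with bits indexed by `linkIdx h k`, computed from what
relay `h` received. Only the pairs `(h, k)` with `h ∈ k.1` are links of the network. -/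
structure Delivery (H r N : ℕ) (β : Type) where
  relayIdx : Fin H → Type
  linkIdx : Fin H → User H r → Type
  finite_relayIdx : ∀ h, Finite (relayIdx h)
  finite_linkIdx : ∀ h k, Finite (linkIdx h k)
  server : Files N β → (h : Fin H) → relayIdx h → ZMod 2
  relay : (h : Fin H) → (k : User H r) → (relayIdx h → ZMod 2) → (linkIdx h k → ZMod 2)

/-- The largest number of bits carried by a link, divided by the file size. -/
def Delivery.maxLoad {H r N : ℕ} {β : Type} (X : Delivery H r N β) : ℝ :=
  ((Finset.univ.sup fun h : Fin H =>
      max (Nat.card (X.relayIdx h))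
        ((usersOf h).sup fun k : User H r => Nat.card (X.linkIdx h k)) : ℕ) : ℝ) /
    (Nat.card β : ℝ)

/-- What user `k` receives from the relays it is connected to. -/
def Delivery.received {H r N : ℕ} {β : Type} (X : Delivery H r N β) (k : User H r)
    (F : Files N β) : (h : k.1) → X.linkIdx h.1 k → ZMod 2 :=
  fun h => X.relay h.1 k (X.server F h.1)

/-- User `k` has a decoder that, from its cache and from what it receives, recovers file `i` with
error probability at most `ε`, the bits of the library being independent and uniform. -/
def Delivery.Recovers {H r N : ℕ} {β : Type} (Z : Placement H r N β) (X : Delivery H r N β)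
    (k : User H r) (i : Fin N) (ε : ℝ) : Prop :=
  ∃ dec : (Z k → ZMod 2) → ((h : k.1) → X.linkIdx h.1 k → ZMod 2) → (β → ZMod 2),
    (Nat.card {F : Files N β // dec (cacheContent Z k F) (X.received k F) ≠ F i} : ℝ) /
      (Nat.card (Files N β) : ℝ) ≤ ε

/-- The max-link load `R` is achievable with uncoded placement and caches of `M` files: for every
`ε > 0` there are a file size, a placement that respects the cache size and, for every demand
vector, a delivery of max-link load at most `R` after which each user recovers the file it
demands with error probability at most `ε`. -/
def UncodedAchievable (H r N : ℕ) (M R : ℝ) : Prop :=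
  ∀ ε : ℝ, 0 < ε → ∃ (β : Type) (_ : Finite β) (_ : Nonempty β) (Z : Placement H r N β),
    (∀ k, ((Z k).card : ℝ) ≤ M * (Nat.card β : ℝ)) ∧
    ∀ d : User H r → Fin N, ∃ X : Delivery H r N β,
      X.maxLoad ≤ R ∧ ∀ k, X.Recovers Z k (d k) ε

/-- `Rstar` is the optimal max-link load under uncoded placement for caches of `M` files. -/
def IsOptimalUncodedLoad (H r N : ℕ) (M Rstar : ℝ) : Prop :=
  IsGLB {R : ℝ | UncodedAchievable H r N M R} Rstar

/-! The caching scheme with the placement of Maddah-Ali and Niesen. -/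

/-- The sets of exactly `t` users. -/
abbrev UserSet (H r t : ℕ) : Type := {W : Finset (User H r) // W.card = t}

/-- The bit positions of a file: every file is split into one sub-file for each set of `t` users,
and a sub-file consists of `n` symbols of `m` bits each. -/
abbrev BitPos (H r t n m : ℕ) : Type := UserSet H r t × (Fin n × Fin m)

/-- User `k` caches the sub-files whose index set contains `k`. -/
def manPlacement (H r N t n m : ℕ) : Placement H r N (BitPos H r t n m) :=
  fun k => Finset.univ.filter fun x => k ∈ x.2.1.1

/-- The relays connected to all users in `J`. -/
def relaysOf {H r : ℕ} (J : Finset (User H r)) : Finset (Fin H) :=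
  Finset.univ.filter fun h => ∀ k ∈ J, h ∈ k.1

/-- The coded message of `J`: the sum modulo 2, over the users `j` in `J`, of the sub-file of the
file demanded by `j` whose index set is `J` without `j`. -/
def codedMessage {H r N t n m : ℕ} (d : User H r → Fin N) (F : Files N (BitPos H r t n m))
    (J : UserSet H r (t + 1)) (p : Fin n × Fin m) : ZMod 2 :=
  ∑ j : J.1, F (d j.1)
    (⟨J.1.erase j.1, by rw [Finset.card_erase_of_mem j.2, J.2]; rfl⟩, p)

/-- The bits sent to relay `h` when some relay serves all of `J`: the piece of the coded message of
`J` that is assigned to `h`, for each `J` with `h ∈ relaysOf J`. The `n` symbols are dealt out in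
turn to the relays in `relaysOf J`, which gives pieces of equal length if the number of these
relays divides `n`. -/
abbrev DirectIdx (H r t n m : ℕ) (h : Fin H) : Type :=
  {x : UserSet H r (t + 1) × (Fin n × Fin m) //
    h ∈ relaysOf x.1.1 ∧
    x.2.1.1 % (relaysOf x.1.1).card = ((relaysOf x.1.1).filter fun i => i < h).card}

/-- The bits sent to relay `h` for the sets `J` that no relay serves completely: `n / r` linear
combinations, of `m` bits each, of the `n` symbols of the coded message of `J`, for each
such `J` that contains a user connected to `h`. -/
abbrev MixedIdx (H r t n m : ℕ) (h : Fin H) : Type :=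
  {x : UserSet H r (t + 1) × (Fin (n / r) × Fin m) //
    relaysOf x.1.1 = ∅ ∧ ∃ k ∈ x.1.1, h ∈ k.1}

/-- The coefficients of the linear combinations, one family for every set of `t + 1` users and
every relay. -/
abbrev Coeffs (H r t n : ℕ) (𝔽 : Type) : Type :=
  UserSet H r (t + 1) → Fin H → Fin (n / r) → Fin n → 𝔽

/-- The delivery of the scheme with coefficients `c` in a field `𝔽` with `2 ^ m` elements, whose
elements are written as `m` bits by means of a basis `b` over `ZMod 2`. Each relay forwards to its
users what it receives. -/
def schemeDelivery {H r N t n m : ℕ} {𝔽 : Type} [Field 𝔽] [Algebra (ZMod 2) 𝔽]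
    (b : Module.Basis (Fin m) (ZMod 2) 𝔽) (c : Coeffs H r t n 𝔽) (d : User H r → Fin N) :
    Delivery H r N (BitPos H r t n m) where
  relayIdx h := DirectIdx H r t n m h ⊕ MixedIdx H r t n m h
  linkIdx h _ := DirectIdx H r t n m h ⊕ MixedIdx H r t n m h
  finite_relayIdx _ := inferInstance
  finite_linkIdx _ _ := inferInstance
  server F h
    | Sum.inl x => codedMessage d F x.1.1 x.1.2
    | Sum.inr x =>
        b.equivFun (∑ i : Fin n, c x.1.1 h x.1.2.1 i *
          b.equivFun.symm (fun a => codedMessage d F x.1.1 (i, a))) x.1.2.2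
  relay _ _ := id

/-- The scheme works for caches of `t * N / K` files, `K = H.choose r`, and has max-link load `ρ`:
for every number `n` of symbols per sub-file for which the divisions of the scheme are exact, each
cache is filled exactly, the max-link load is `ρ` for all demands, and the probability that, with
independent uniform coefficients, all users recover their files without error for all demands
tends to 1 as the number `m` of bits per symbol grows. -/
def SchemeAchieves (H r N t : ℕ) (ρ : ℝ) : Prop :=
  ∀ n : ℕ, 0 < n → r ! ∣ n →
    (∀ m : ℕ, 0 < m → ∀ k, ((manPlacement H r N t n m k).card : ℝ) =
      ((t : ℝ) * N / (H.choose r : ℝ)) * (Nat.card (BitPos H r t n m) : ℝ)) ∧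
    (∀ (m : ℕ) (𝔽 : Type) [Field 𝔽] [Algebra (ZMod 2) 𝔽]
      (b : Module.Basis (Fin m) (ZMod 2) 𝔽) (c : Coeffs H r t n 𝔽) (d : User H r → Fin N),
      (schemeDelivery b c d).maxLoad = ρ) ∧
    ∀ ε : ℝ, 0 < ε → ∃ m₀ : ℕ, ∀ m : ℕ, m₀ ≤ m →
      ∀ (𝔽 : Type) [Field 𝔽] [Algebra (ZMod 2) 𝔽] (b : Module.Basis (Fin m) (ZMod 2) 𝔽),
        (1 - ε) * (Nat.card (Coeffs H r t n 𝔽) : ℝ) ≤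
          (Nat.card {c : Coeffs H r t n 𝔽 // ∀ (d : User H r → Fin N) (k : User H r),
            (schemeDelivery b c d).Recovers (manPlacement H r N t n m) k (d k) 0} : ℝ)

/-! The uncoded cut-set bound. -/

/-- The load `(C - t) / (x * (t + 1))` with `C = x.choose r`. -/
def cutSetPoint (r x t : ℕ) : ℝ :=
  ((x.choose r : ℝ) - t) / ((x : ℝ) * ((t : ℝ) + 1))

/-- The piecewise linear curve in `M ∈ [0, N]` through the points
`(t * N / C, cutSetPoint r x t)`, where `C = x.choose r` and `t = 0, …, C`. -/
def cutSetCurve (N r x : ℕ) (M : ℝ) : ℝ :=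
  let s : ℝ := M * (x.choose r : ℝ) / N
  let t : ℕ := ⌊s⌋₊
  (1 - (s - t)) * cutSetPoint r x t + (s - t) * cutSetPoint r x (t + 1)

/-- `v` is the value of the uncoded cut-set bound at `M`: the largest value of the curves for
`x = r, …, H`. -/
def IsCutSetBound (H r N : ℕ) (M v : ℝ) : Prop :=
  IsGreatest ((fun x : ℕ => cutSetCurve N r x M) '' Set.Icc r H) v

end CombNet

end

namespace CombNet

/-! When `r = H - 1`, a user is determined by the one relay that it does not hear, so the relays
serving all of a set `J` are exactly those whose omitted user lies outside `J`. Hence for `t < r`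
every coded message is sent directly in `r - t` pieces. For `t = r` the only message is that of all
users, and each relay gets combinations amounting to a fraction `1 / r` of it. Counting gives the
closed form `optimalLoad`. In the mixed case a user hears `r * (n / r) = n` combinations of `n`
symbols. The product of all the determinants involved is a nonzero polynomial whose degree does not
depend on the field, so by Schwartz–Zippel (`card_eval_eq_zero_le`) failure is rare over a large
field.

For the converse, let the users of a set decode one after another, each using what the earlier ones
decoded: the relay messages must carry every demanded bit that is still new at its turn
(`ncard_newBits_le`). A single user, summed over all files, yields a line in `M`. All users,
averaged over decoding orders and over shifts of a vector of distinct demands, yield a charge `(K -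
s) / (s + 1)` for each bit cached by `s` users (`sum_cached_le`). The chords of this convex function
(`chord_le`) yield further lines.

These lines are the curve for `x = r` and the extended segments of the curve for `x = H`. All
operating points lie on or above all of them, and each segment between consecutive operating points
lies on one: on an all-users line if `t + 1 < r`, on the single-user line otherwise. Memory sharing
therefore meets the lower bound (`interpolatedLoad_spec`). -/

/-! ### Error-free decoding of the scheme. -/

/-- If the cache of user `k` and what it receives determine file `i`, then the user can decode
file `i` without error. -/
lemma recovers_zero_of_determined {H r N : ℕ} {β : Type} [Finite β] {Z : Placement H r N β}
    {X : Delivery H r N β} {k : User H r} {i : Fin N}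
    (h : ∀ F F' : Files N β, cacheContent Z k F = cacheContent Z k F' →
      X.received k F = X.received k F' → F i = F' i) : X.Recovers Z k i 0 := by
  classical
  -- The decoder picks any library consistent with its observations; the default `0` is never
  -- reached on actual observations.
  refine ⟨fun z y => if hF : ∃ F : Files N β, cacheContent Z k F = z ∧ X.received k F = y
    then hF.choose i else 0, ?_⟩
  have hempty : IsEmpty {F : Files N β //
      (if hF : ∃ F' : Files N β, cacheContent Z k F' = cacheContent Z k F ∧
        X.received k F' = X.received k F then hF.choose i else 0) ≠ F i} := by
    refine ⟨fun F => F.2 ?_⟩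
    have hF : ∃ F' : Files N β, cacheContent Z k F' = cacheContent Z k F.1 ∧
        X.received k F' = X.received k F.1 := ⟨F.1, rfl, rfl⟩
    rw [dif_pos hF]
    exact h _ _ hF.choose_spec.1 hF.choose_spec.2
  simp only [Nat.card_eq_zero.2 (Or.inl hempty)]
  simp

/-- A user that decodes without error has a decoder that is always right. -/
lemma Delivery.Recovers.exists_decoder {H r N : ℕ} {β : Type} [Finite β]
    {Z : Placement H r N β} {X : Delivery H r N β} {k : User H r} {i : Fin N}
    (h : X.Recovers Z k i 0) : ∃ dec : (Z k → ZMod 2) →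
      ((h : k.1) → X.linkIdx h.1 k → ZMod 2) → (β → ZMod 2),
      ∀ F, dec (cacheContent Z k F) (X.received k F) = F i := by
  obtain ⟨dec, hdec⟩ := h
  refine ⟨dec, fun F => ?_⟩
  by_contra hF
  have h1 : 0 < Nat.card {F : Files N β // dec (cacheContent Z k F) (X.received k F) ≠ F i} :=
    Nat.card_pos_iff.2 ⟨⟨⟨F, hF⟩⟩, inferInstance⟩
  have h2 : 0 < Nat.card (Files N β) := Nat.card_pos_iff.2 ⟨⟨F⟩, inferInstance⟩
  have h3 : (0 : ℝ) < (Nat.card {F : Files N β //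
      dec (cacheContent Z k F) (X.received k F) ≠ F i} : ℝ) / (Nat.card (Files N β) : ℝ) := by
    positivity
  exact absurd hdec (not_le.2 h3)

/-- Every position below the size of a finite set is the rank of one of its elements. -/
lemma exists_card_filter_lt_eq {α : Type*} [LinearOrder α] (s : Finset α) :
    ∀ j < s.card, ∃ a ∈ s, (s.filter fun i => i < a).card = j := by
  refine Finset.induction_on_max s (by simp) fun a s ha ih => ?_
  · intro j hj
    have has : a ∉ s := fun h => lt_irrefl _ (ha a h)
    rw [Finset.card_insert_of_notMem has] at hj
    rcases Nat.lt_succ_iff_lt_or_eq.1 hj with hj | rfl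
    · obtain ⟨b, hb, hbj⟩ := ih j hj
      refine ⟨b, Finset.mem_insert_of_mem hb, ?_⟩
      rw [Finset.filter_insert, if_neg (not_lt.2 (ha b hb).le), hbj]
    · refine ⟨a, Finset.mem_insert_self _ _, ?_⟩
      rw [Finset.filter_insert, if_neg (lt_irrefl a), Finset.filter_true_of_mem ha]

/-- The linear combinations that user `k` obtains of the coded message of a set of users, as a
function of the symbols of the coded message. -/
def combine {H r t n : ℕ} {𝔽 : Type} [Field 𝔽] (c : Coeffs H r t n 𝔽)
    (J : UserSet H r (t + 1)) (k : User H r) (v : Fin n → 𝔽) (x : k.1 × Fin (n / r)) : 𝔽 :=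
  ∑ i, c J x.1.1 x.2 i * v i

/-- If each user can invert the linear combinations that it obtains, it recovers its file. -/
lemma schemeDelivery_recovers {H r N t n m : ℕ} {𝔽 : Type} [Field 𝔽] [Algebra (ZMod 2) 𝔽]
    (b : Module.Basis (Fin m) (ZMod 2) 𝔽) (c : Coeffs H r t n 𝔽) (d : User H r → Fin N)
    (k : User H r)
    (hc : ∀ J : UserSet H r (t + 1), k ∈ J.1 → Function.Injective (combine c J k)) :
    (schemeDelivery b c d).Recovers (manPlacement H r N t n m) k (d k) 0 := by
  classical
  refine recovers_zero_of_determined fun F F' hcache hrec => ?_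
  have hcached : ∀ (f : Fin N) (W : UserSet H r t) (p : Fin n × Fin m), k ∈ W.1 →
      F f (W, p) = F' f (W, p) := fun f W p hk =>
    congrFun hcache ⟨(f, (W, p)), by simpa [manPlacement] using hk⟩
  have hcoded : ∀ (J : UserSet H r (t + 1)), k ∈ J.1 →
      ∀ p, codedMessage d F J p = codedMessage d F' J p := by
    intro J hkJ p
    rcases (relaysOf J.1).eq_empty_or_nonempty with hJ | hJ
    · have hv : (fun i => b.equivFun.symm (fun a => codedMessage d F J (i, a))) =
          fun i => b.equivFun.symm (fun a => codedMessage d F' J (i, a)) := by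
        refine hc J hkJ (funext fun x => ?_)
        refine b.equivFun.injective (funext fun a => ?_)
        exact congrFun (congrFun hrec x.1) (Sum.inr ⟨(J, (x.2, a)), hJ, k, hkJ, x.1.2⟩)
      have h1 := b.equivFun.symm.injective (congrFun hv p.1)
      exact congrFun h1 p.2
    -- The symbol travels through the relay whose rank is its residue; this relay serves all of `J`,
    -- hence `k`.
    · obtain ⟨h, hh, hj⟩ := exists_card_filter_lt_eq (relaysOf J.1)
        (p.1.1 % (relaysOf J.1).card) (Nat.mod_lt _ hJ.card_pos)
      have hhk : h ∈ k.1 := (Finset.mem_filter.1 hh).2 k hkJ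
      exact congrFun (congrFun hrec ⟨h, hhk⟩) (Sum.inl ⟨(J, p), hh, hj.symm⟩)
  funext x
  obtain ⟨W, p⟩ := x
  by_cases hk : k ∈ W.1
  · exact hcached _ W p hk
  -- A missing sub-file `W` is read off the message of `W ∪ {k}`: the index sets of all the other
  -- summands contain `k`, so `k` caches them and they cancel.
  have hkJ : k ∈ insert k W.1 := Finset.mem_insert_self _ _
  have h := hcoded ⟨insert k W.1, by rw [Finset.card_insert_of_notMem hk, W.2]⟩ hkJ p
  unfold codedMessage at h
  rw [← Finset.add_sum_erase Finset.univ _ (Finset.mem_univ (⟨k, hkJ⟩ : {j // j ∈ insert k W.1})),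
    ← Finset.add_sum_erase Finset.univ _ (Finset.mem_univ (⟨k, hkJ⟩ : {j // j ∈ insert k W.1}))]
    at h
  rw [Finset.sum_congr rfl (fun j hj => hcached (d j.1) _ p (Finset.mem_erase.2
    ⟨fun hjk => (Finset.mem_erase.1 hj).1 (Subtype.ext hjk.symm), hkJ⟩))] at h
  have h' := add_right_cancel h
  simpa only [Finset.erase_insert hk] using h'

/-! ### Random coefficients over a large field. -/

/-- The **Schwartz–Zippel lemma** for an arbitrary finite set of variables that range over a
finite field. -/
lemma card_eval_eq_zero_le {σ R : Type*} [Finite σ] [Field R] [Finite R]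
    {p : MvPolynomial σ R} (hp : p ≠ 0) :
    (Nat.card {f : σ → R // MvPolynomial.eval f p = 0} : ℝ) ≤
      p.totalDegree / Nat.card R * Nat.card (σ → R) := by
  classical
  have := Fintype.ofFinite R
  obtain ⟨s, ⟨e⟩⟩ := Finite.exists_equiv_fin σ
  have := Fintype.ofEquiv _ e.symm
  have hp' : MvPolynomial.rename e p ≠ 0 := fun h =>
    hp (MvPolynomial.rename_injective e e.injective (by rw [h, map_zero]))
  have h := MvPolynomial.schwartz_zippel_totalDegree hp' (Finset.univ : Finset R)
  have hdeg : (MvPolynomial.rename e p).totalDegree = p.totalDegree := by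
    exact MvPolynomial.totalDegree_renameEquiv (f := e) (p := p)
  have hcard : Nat.card {f : σ → R // MvPolynomial.eval f p = 0} =
      ((Fintype.piFinset fun _ : Fin s => (Finset.univ : Finset R)).filter
        fun f => MvPolynomial.eval f (MvPolynomial.rename e p) = 0).card := by
    rw [Nat.card_congr ((Equiv.arrowCongr e (Equiv.refl R)).subtypeEquiv
      (q := fun f => MvPolynomial.eval f (MvPolynomial.rename e p) = 0) ?_)]
    · rw [Nat.card_eq_fintype_card, Fintype.card_subtype]
      simp
    · intro f
      rw [MvPolynomial.eval_rename]
      have : ((e.arrowCongr (Equiv.refl R)) f) ∘ e = f := by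
        funext x; simp [Equiv.arrowCongr]
      rw [this]
  rw [hdeg, ← hcard] at h
  have h' : (Nat.card {f : σ → R // MvPolynomial.eval f p = 0} : ℝ) / (Fintype.card R : ℝ) ^ s ≤
      p.totalDegree / (Fintype.card R : ℝ) := by
    have := (NNRat.cast_le (K := ℝ)).2 h
    simpa using this
  have hpos : (0 : ℝ) < (Fintype.card R : ℝ) ^ s := by
    have := Fintype.card_pos (α := R)
    positivity
  rw [div_le_iff₀ hpos] at h'
  have hs : (Nat.card (σ → R) : ℝ) = (Fintype.card R : ℝ) ^ s := by
    rw [Nat.card_congr (Equiv.arrowCongr e (Equiv.refl R))]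
    simp
  rw [hs, Nat.card_eq_fintype_card (α := R)]
  exact h'

/-- The entries of a family of coefficients, as independent variables. -/
abbrev CoeffIdx (H r t n : ℕ) : Type := UserSet H r (t + 1) × Fin H × Fin (n / r) × Fin n

/-- A family of coefficients as a function of one index. -/
def coeffsEquiv (H r t n : ℕ) (𝔽 : Type) : Coeffs H r t n 𝔽 ≃ (CoeffIdx H r t n → 𝔽) where
  toFun c x := c x.1 x.2.1 x.2.2.1 x.2.2.2
  invFun f J h a i := f (J, h, a, i)

/-- This makes the linear system of a user square, so that a determinant decides whether it can be
inverted. -/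
lemma card_link_combinations {H r n : ℕ} (hrn : r ∣ n) (k : User H r) :
    Fintype.card (k.1 × Fin (n / r)) = Fintype.card (Fin n) := by
  simp [k.2, Nat.mul_div_cancel' hrn]

/-- The position in a family of coefficients of an entry of the matrix of the linear combinations
of the coded message of `J` that user `k` obtains. -/
noncomputable def entryIdx {H r n : ℕ} (t : ℕ) (hrn : r ∣ n) (J : UserSet H r (t + 1)) (k : User H r)
    (x : Fin n × Fin n) : CoeffIdx H r t n :=
  let y := (Fintype.equivOfCardEq (card_link_combinations hrn k)).symm x.1
  (J, y.1.1, y.2, x.2)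

lemma entryIdx_injective {H r n t : ℕ} (hrn : r ∣ n) (J : UserSet H r (t + 1)) (k : User H r) :
    Function.Injective (entryIdx t hrn J k) := by
  rintro ⟨x, i⟩ ⟨x', i'⟩ h
  simp only [entryIdx, Prod.mk.injEq, true_and] at h
  obtain ⟨h1, h2, rfl⟩ := h
  have := (Fintype.equivOfCardEq (card_link_combinations hrn k)).symm.injective
    (Prod.ext (Subtype.ext h1) h2)
  rw [this]

/-- The product of the determinants of all the matrices that users have to invert, as a polynomial
in the coefficients. -/
noncomputable def decodingPoly {H r n : ℕ} (t : ℕ) (hrn : r ∣ n) :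
    MvPolynomial (CoeffIdx H r t n) (ZMod 2) :=
  ∏ x : UserSet H r (t + 1) × User H r, MvPolynomial.rename (entryIdx t hrn x.1 x.2)
    (Matrix.det (Matrix.mvPolynomialX (Fin n) (Fin n) (ZMod 2)))

/-- Distinct entries of one user's matrix are distinct variables, so each factor is an injective
renaming of the generic determinant, and the polynomial ring is a domain. -/
lemma decodingPoly_ne_zero {H r n : ℕ} (t : ℕ) (hrn : r ∣ n) :
    decodingPoly (H := H) t hrn ≠ 0 := by
  refine Finset.prod_ne_zero_iff.2 fun x _ h => ?_
  refine Matrix.det_mvPolynomialX_ne_zero (Fin n) (ZMod 2)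
    (MvPolynomial.rename_injective _ (entryIdx_injective hrn x.1 x.2) ?_)
  rw [h, map_zero]

/-- If the product is nonzero at `c`, so is each factor, which is the determinant of one user's
matrix. The polynomial has coefficients in `ZMod 2`, so one polynomial serves all the fields. -/
lemma combine_injective_of_aeval_ne_zero {H r t n : ℕ} {𝔽 : Type} [Field 𝔽] [Algebra (ZMod 2) 𝔽]
    (hrn : r ∣ n) (c : Coeffs H r t n 𝔽)
    (hc : MvPolynomial.aeval (coeffsEquiv H r t n 𝔽 c) (decodingPoly (H := H) t hrn) ≠ 0)
    (J : UserSet H r (t + 1)) (k : User H r) : Function.Injective (combine c J k) := by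
  classical
  rw [decodingPoly, map_prod] at hc
  have h := Finset.prod_ne_zero_iff.1 hc (J, k) (Finset.mem_univ _)
  simp only [MvPolynomial.aeval_rename] at h
  rw [AlgHom.map_det] at h
  have hA := Matrix.mvPolynomialX_mapMatrix_aeval (ZMod 2)
    (Matrix.of fun i j : Fin n => coeffsEquiv H r t n 𝔽 c (entryIdx t hrn J k (i, j)))
  have hfun : (coeffsEquiv H r t n 𝔽 c ∘ entryIdx t hrn J k) = fun p : Fin n × Fin n =>
    (Matrix.of fun i j : Fin n => coeffsEquiv H r t n 𝔽 c (entryIdx t hrn J k (i, j))) p.1 p.2 :=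
    rfl
  rw [hfun, hA] at h
  have hinj := Matrix.mulVec_injective_of_isUnit
    ((Matrix.isUnit_iff_isUnit_det _).2 (isUnit_iff_ne_zero.2 h))
  intro v w hvw
  refine hinj (funext fun i => ?_)
  exact congrFun hvw ((Fintype.equivOfCardEq (card_link_combinations hrn k)).symm i)

lemma card_of_basis {m : ℕ} {𝔽 : Type} [Field 𝔽] [Algebra (ZMod 2) 𝔽]
    (b : Module.Basis (Fin m) (ZMod 2) 𝔽) : Nat.card 𝔽 = 2 ^ m := by
  rw [Nat.card_congr b.equivFun.toEquiv]
  simp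

/-- As the field grows, the proportion of the families of coefficients with which all users recover
their files without error for all demands tends to 1. -/
lemma exists_le_card_recovers (H r N t n : ℕ) (hrn : r ∣ n) (ε : ℝ) (hε : 0 < ε) :
    ∃ m₀ : ℕ, ∀ m : ℕ, m₀ ≤ m →
      ∀ (𝔽 : Type) [Field 𝔽] [Algebra (ZMod 2) 𝔽] (b : Module.Basis (Fin m) (ZMod 2) 𝔽),
        (1 - ε) * (Nat.card (Coeffs H r t n 𝔽) : ℝ) ≤
          (Nat.card {c : Coeffs H r t n 𝔽 // ∀ (d : User H r → Fin N) (k : User H r),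
            (schemeDelivery b c d).Recovers (manPlacement H r N t n m) k (d k) 0} : ℝ) := by
  classical
  -- With `degree / ε < m₀ ≤ m ≤ 2 ^ m`, the Schwartz–Zippel fraction `degree / 2 ^ m` is at most
  -- `ε`.
  obtain ⟨m₀, hm₀⟩ := exists_nat_gt
    (((decodingPoly (H := H) t hrn).totalDegree : ℝ) / ε)
  refine ⟨m₀, fun m hm 𝔽 _ _ b => ?_⟩
  have : Finite 𝔽 := Nat.finite_of_card_ne_zero (by rw [card_of_basis b]; positivity)
  set p := decodingPoly (H := H) t hrn
  set q := MvPolynomial.map (algebraMap (ZMod 2) 𝔽) p with hq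
  have hq0 : q ≠ 0 := fun h => decodingPoly_ne_zero (H := H) t hrn
    (MvPolynomial.map_injective _ (algebraMap (ZMod 2) 𝔽).injective (by rw [map_zero]; exact h))
  have hdeg : q.totalDegree ≤ p.totalDegree :=
    Finset.sup_mono (MvPolynomial.support_map_subset _ _)
  have hzero := card_eval_eq_zero_le hq0
  rw [card_of_basis b] at hzero
  have hfrac : (q.totalDegree : ℝ) / ((2 ^ m : ℕ) : ℝ) ≤ ε := by
    rw [div_le_iff₀ (by positivity)]
    have h1 : (m : ℝ) ≤ ((2 ^ m : ℕ) : ℝ) := by exact_mod_cast Nat.lt_two_pow_self.le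
    have h2 : (m₀ : ℝ) ≤ m := by exact_mod_cast hm
    have h3 : (q.totalDegree : ℝ) ≤ p.totalDegree := by exact_mod_cast hdeg
    rw [div_lt_iff₀ hε] at hm₀
    nlinarith
  have hsplit : Nat.card (CoeffIdx H r t n → 𝔽) =
      Nat.card {f : CoeffIdx H r t n → 𝔽 // MvPolynomial.eval f q = 0} +
      Nat.card {f : CoeffIdx H r t n → 𝔽 // ¬ MvPolynomial.eval f q = 0} := by
    rw [← Nat.card_sum]
    exact Nat.card_congr (Equiv.sumCompl _).symm
  have hgood : Nat.card {f : CoeffIdx H r t n → 𝔽 // ¬ MvPolynomial.eval f q = 0} ≤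
      Nat.card {c : Coeffs H r t n 𝔽 // ∀ (d : User H r → Fin N) (k : User H r),
        (schemeDelivery b c d).Recovers (manPlacement H r N t n m) k (d k) 0} := by
    refine Nat.card_le_card_of_injective
      (fun f => ⟨(coeffsEquiv H r t n 𝔽).symm f.1, fun d k => ?_⟩) ?_
    · refine schemeDelivery_recovers b _ d k fun J _ =>
        combine_injective_of_aeval_ne_zero hrn _ ?_ J k
      rw [Equiv.apply_symm_apply, MvPolynomial.aeval_def, ← MvPolynomial.eval_map]
      exact f.2
    · intro f g hfg
      exact Subtype.ext ((coeffsEquiv H r t n 𝔽).symm.injective (congrArg Subtype.val hfg))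
  have hgood' : (Nat.card {f : CoeffIdx H r t n → 𝔽 // ¬ MvPolynomial.eval f q = 0} : ℝ) ≤ _ :=
    Nat.cast_le.2 hgood
  refine le_trans ?_ hgood'
  rw [Nat.card_congr (coeffsEquiv H r t n 𝔽)]
  have hs : (Nat.card (CoeffIdx H r t n → 𝔽) : ℝ) = _ := congrArg Nat.cast hsplit
  rw [Nat.cast_add] at hs
  have hT : (0 : ℝ) ≤ Nat.card (CoeffIdx H r t n → 𝔽) := Nat.cast_nonneg _
  nlinarith [mul_le_mul_of_nonneg_right hfrac hT]

/-! ### Counting users, sub-files and cached bits. -/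

lemma card_user (H r : ℕ) : Fintype.card (User H r) = H.choose r := by
  simp [User, Fintype.card_subtype]

lemma card_userSet (H r t : ℕ) : Fintype.card (UserSet H r t) = (H.choose r).choose t := by
  classical
  rw [← card_user H r, Fintype.card_subtype, ← Finset.card_univ (α := User H r),
    ← Finset.card_powersetCard]
  congr 1
  ext s
  simp [Finset.mem_powersetCard]

lemma card_bitPos (H r t n m : ℕ) :
    Nat.card (BitPos H r t n m) = (H.choose r).choose t * (n * m) := by
  rw [Nat.card_eq_fintype_card, Fintype.card_prod, card_userSet]
  simp

/-- The number of sets of `s` users contained in a given set of users. -/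
lemma card_userSet_subset {H r : ℕ} (s : ℕ) (A : Finset (User H r)) :
    Fintype.card {W : UserSet H r s // W.1 ⊆ A} = A.card.choose s := by
  classical
  rw [← Finset.card_powersetCard, ← Fintype.card_coe]
  refine Fintype.card_congr ⟨fun W => ⟨W.1.1, Finset.mem_powersetCard.2 ⟨W.2, W.1.2⟩⟩,
    fun W => ⟨⟨W.1, (Finset.mem_powersetCard.1 W.2).2⟩, (Finset.mem_powersetCard.1 W.2).1⟩,
    fun _ => rfl, fun _ => rfl⟩

/-- Each user is in a fraction `t / K` of the sets of `t` users. -/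
lemma card_userSet_mem {H r : ℕ} (t : ℕ) (k : User H r) :
    H.choose r * Fintype.card {W : UserSet H r t // k ∈ W.1} = t * (H.choose r).choose t := by
  classical
  -- The sets avoiding `k` are the subsets of the other `K - 1` users; Pascal's rule then leaves
  -- those containing `k`.
  have h1 := card_userSet_subset t (Finset.univ.erase k)
  have h2 : Fintype.card {W : UserSet H r t // k ∈ W.1} +
      Fintype.card {W : UserSet H r t // W.1 ⊆ Finset.univ.erase k} =
      (H.choose r).choose t := by
    rw [← card_userSet, ← Fintype.card_sum]
    refine Fintype.card_congr (Equiv.trans (Equiv.sumCongr (Equiv.refl _)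
      (Equiv.subtypeEquivRight fun W => ?_)) (Equiv.sumCompl fun W : UserSet H r t => k ∈ W.1))
    simp [Finset.subset_erase]
  rw [Finset.card_erase_of_mem (Finset.mem_univ k), Finset.card_univ, card_user] at h1
  rw [h1] at h2
  have hK : 0 < H.choose r := by rw [← card_user]; exact Fintype.card_pos_iff.2 ⟨k⟩
  obtain ⟨K, hK'⟩ : ∃ K, H.choose r = K + 1 := ⟨_, (Nat.succ_pred hK.ne').symm⟩
  rw [hK'] at h2 ⊢
  rw [Nat.add_sub_cancel] at h2
  rcases t with _ | t
  · rw [zero_mul, mul_eq_zero]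
    rw [Nat.choose_zero_right, Nat.choose_zero_right] at h2
    exact Or.inr (by omega)
  · rw [Nat.choose_succ_succ'] at h2
    have h3 := Nat.add_one_mul_choose_eq K t
    have : Fintype.card {W : UserSet H r (t + 1) // k ∈ W.1} = K.choose t := by omega
    rw [this, h3, mul_comm]

lemma card_manPlacement {H r N t n m : ℕ} (k : User H r) :
    ((manPlacement H r N t n m k).card : ℝ) =
      ((t : ℝ) * N / (H.choose r : ℝ)) * (Nat.card (BitPos H r t n m) : ℝ) := by
  classical
  have h1 : (manPlacement H r N t n m k).card =
      N * (Fintype.card {W : UserSet H r t // k ∈ W.1} * (n * m)) := by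
    have : manPlacement H r N t n m k = (Finset.univ : Finset (Fin N)) ×ˢ
        ((Finset.univ.filter fun W : UserSet H r t => k ∈ W.1) ×ˢ
          (Finset.univ : Finset (Fin n × Fin m))) := by
      ext x
      simp [manPlacement]
    rw [this, Finset.card_product, Finset.card_product, Fintype.card_subtype]
    simp
  have hK : 0 < H.choose r := by rw [← card_user]; exact Fintype.card_pos_iff.2 ⟨k⟩
  have h2 : ((H.choose r : ℕ) : ℝ) * (Fintype.card {W : UserSet H r t // k ∈ W.1} : ℝ) =
      t * ((H.choose r).choose t : ℝ) := by exact_mod_cast card_userSet_mem t k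
  rw [h1, card_bitPos]
  push_cast
  have hK' : ((H.choose r : ℕ) : ℝ) ≠ 0 := by positivity
  field_simp
  linear_combination (N : ℝ) * n * m * h2

/-- The residues modulo a divisor of `n` are equally frequent below `n`. -/
lemma card_fin_mod_eq {n c j : ℕ} (hc : c ∣ n) (hj : j < c) :
    Fintype.card {i : Fin n // i.1 % c = j} = n / c := by
  obtain ⟨q, rfl⟩ := hc
  rw [Nat.mul_div_cancel_left _ (by omega)]
  conv_rhs => rw [← Fintype.card_fin q]
  refine Fintype.card_congr ⟨fun i => ⟨i.1.1 / c, Nat.div_lt_of_lt_mul i.1.2⟩,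
    fun a => ⟨⟨j + c * a.1, ?_⟩, ?_⟩, fun i => ?_, fun a => ?_⟩
  · have := a.2
    nlinarith
  · rw [Nat.add_mul_mod_self_left, Nat.mod_eq_of_lt hj]
  · apply Subtype.ext
    apply Fin.ext
    obtain ⟨i, rfl⟩ := i
    exact Nat.mod_add_div _ _
  · apply Fin.ext
    change (j + c * a.1) / c = a.1
    rw [Nat.add_mul_div_left _ _ (by omega), Nat.div_eq_of_lt hj, zero_add]

/-! Combination networks with `r + 1` relays: each user is connected to all relays but one. -/

/-- The user connected to all relays except `i`. -/
def userOmitting {r : ℕ} (i : Fin (r + 1)) : User (r + 1) r :=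
  ⟨{i}ᶜ, by simp [Finset.card_compl]⟩

lemma mem_userOmitting {r : ℕ} {i h : Fin (r + 1)} : h ∈ (userOmitting i).1 ↔ h ≠ i := by
  simp [userOmitting]

lemma userOmitting_bijective (r : ℕ) : Function.Bijective (userOmitting (r := r)) := by
  refine (Fintype.bijective_iff_injective_and_card _).2 ⟨fun i j hij => ?_, ?_⟩
  · by_contra hne
    have : i ∈ (userOmitting j).1 := mem_userOmitting.2 hne
    rw [← hij] at this
    exact mem_userOmitting.1 this rfl
  · rw [card_user]
    simp

lemma exists_userOmitting_eq {r : ℕ} (k : User (r + 1) r) : ∃ i, userOmitting i = k :=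
  (userOmitting_bijective r).2 k

/-- The only user that relay `h` does not serve is the one omitting `h`. -/
lemma mem_relaysOf_iff {r : ℕ} {J : Finset (User (r + 1) r)} {h : Fin (r + 1)} :
    h ∈ relaysOf J ↔ userOmitting h ∉ J := by
  constructor
  · intro hh hJ
    exact mem_userOmitting.1 ((Finset.mem_filter.1 hh).2 _ hJ) rfl
  · intro hh
    refine Finset.mem_filter.2 ⟨Finset.mem_univ _, fun k hk => ?_⟩
    obtain ⟨i, rfl⟩ := exists_userOmitting_eq k
    refine mem_userOmitting.2 ?_
    rintro rfl
    exact hh hk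

lemma card_relaysOf {r : ℕ} (J : Finset (User (r + 1) r)) :
    (relaysOf J).card = r + 1 - J.card := by
  classical
  have h1 : (relaysOf J).card = Jᶜ.card := by
    refine Finset.card_bij (fun h _ => userOmitting h) ?_ ?_ ?_
    · intro h hh
      exact Finset.mem_compl.2 (mem_relaysOf_iff.1 hh)
    · intro a _ b _ hab
      exact (userOmitting_bijective r).1 hab
    · intro k hk
      obtain ⟨i, rfl⟩ := exists_userOmitting_eq k
      exact ⟨i, mem_relaysOf_iff.2 (Finset.mem_compl.1 hk), rfl⟩
  rw [h1, Finset.card_compl, card_user]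
  simp

lemma card_userSet_relay {r : ℕ} (s : ℕ) (h : Fin (r + 1)) :
    Fintype.card {J : UserSet (r + 1) r s // h ∈ relaysOf J.1} = r.choose s := by
  classical
  have h1 := card_userSet_subset s (Finset.univ.erase (userOmitting h))
  rw [Finset.card_erase_of_mem (Finset.mem_univ _), Finset.card_univ, card_user] at h1
  simp only [Nat.choose_succ_self_right, Nat.add_sub_cancel] at h1
  rw [← h1]
  refine Fintype.card_congr (Equiv.subtypeEquivRight fun W => ?_)
  rw [mem_relaysOf_iff]
  simp [Finset.subset_erase]

/-- Every `J` served by `h` is served by `r - t` relays in all, and `r - t` divides `r !`, so the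
piece for `h` has exactly `n / (r - t)` symbols. For `t ≥ r` there is no such `J` and both sides
vanish. -/
lemma card_directIdx {r t n m : ℕ} (hn : r ! ∣ n) (h : Fin (r + 1)) :
    Nat.card (DirectIdx (r + 1) r t n m h) = r.choose (t + 1) * (n / (r - t) * m) := by
  classical
  have e : DirectIdx (r + 1) r t n m h ≃
      Σ J : {J : UserSet (r + 1) r (t + 1) // h ∈ relaysOf J.1},
        {i : Fin n // i.1 % (relaysOf J.1.1).card =
          ((relaysOf J.1.1).filter fun i => i < h).card} × Fin m :=
    ⟨fun x => ⟨⟨x.1.1, x.2.1⟩, ⟨x.1.2.1, x.2.2⟩, x.1.2.2⟩,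
      fun y => ⟨(y.1.1, (y.2.1.1, y.2.2)), y.1.2, y.2.1.2⟩, fun _ => rfl, fun _ => rfl⟩
  rw [Nat.card_congr e, Nat.card_eq_fintype_card, Fintype.card_sigma,
    Finset.sum_congr rfl (g := fun _ => n / (r - t) * m), Finset.sum_const, Finset.card_univ,
    card_userSet_relay, smul_eq_mul]
  rintro J -
  have hcard : (relaysOf J.1.1).card = r - t := by
    rw [card_relaysOf, J.1.2]; omega
  have hpos : 0 < (relaysOf J.1.1).card := Finset.card_pos.2 ⟨h, J.2⟩
  rw [Fintype.card_prod, card_fin_mod_eq, hcard, Fintype.card_fin]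
  · rw [hcard] at hpos ⊢
    exact (Nat.dvd_factorial hpos (Nat.sub_le r t)).trans hn
  · refine Finset.card_lt_card ((Finset.filter_ssubset).2 ⟨h, J.2, lt_irrefl h⟩)

/-- No relay serves all of `J` only if `J` consists of all `r + 1` users, which forces `t = r`. As
`r ≥ 1`, there is a relay other than `h`, and the user omitting it hears `h`. -/
lemma card_mixedIdx {r t n m : ℕ} (hr : 1 ≤ r) (h : Fin (r + 1)) :
    Nat.card (MixedIdx (r + 1) r t n m h) = if t = r then n / r * m else 0 := by
  classical
  split_ifs with ht
  · subst ht
    have hall : ∀ J : UserSet (t + 1) t (t + 1), J.1 = Finset.univ := fun J =>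
      Finset.eq_univ_of_card _ (by rw [J.2, card_user]; simp)
    have : Nontrivial (Fin (t + 1)) := Fin.nontrivial_iff_two_le.2 (by omega)
    obtain ⟨i, hi⟩ := exists_ne h
    have e : MixedIdx (t + 1) t t n m h ≃ UserSet (t + 1) t (t + 1) × (Fin (n / t) × Fin m) :=
      Equiv.subtypeUnivEquiv fun x => by
        refine ⟨?_, userOmitting i, ?_, mem_userOmitting.2 hi.symm⟩
        · rw [← Finset.card_eq_zero, card_relaysOf, x.1.2, Nat.sub_self]
        · rw [hall]; exact Finset.mem_univ _
    rw [Nat.card_congr e, Nat.card_eq_fintype_card, Fintype.card_prod, card_userSet]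
    simp
  · refine Nat.card_eq_zero.2 (Or.inl ⟨fun x => ?_⟩)
    have h1 : (relaysOf x.1.1.1).card = 0 := by rw [x.2.1]; rfl
    have h2 : x.1.1.1.card ≤ r + 1 := by
      refine (Finset.card_le_univ _).trans ?_
      rw [card_user]; simp
    rw [card_relaysOf] at h1
    have := x.1.1.2
    omega

/-- The max-link load of the scheme with `r + 1` relays and caches of `t * N / (r + 1)` files. -/
noncomputable def optimalLoad (r t : ℕ) : ℝ :=
  ((r : ℝ) + 1 - t) / (((r : ℝ) + 1) * (min (t + 1) r : ℕ))

/-- By symmetry and plain forwarding, all links carry the same number of bits. The minimum in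
`optimalLoad` merges the regimes: direct pieces for `t < r`, the single mixed message for `t = r`;
for `t = r + 1` nothing is sent. -/
lemma schemeDelivery_maxLoad {r N t n m : ℕ} (hr : 1 ≤ r) (ht : t ≤ r + 1) (hn0 : 0 < n)
    (hn : r ! ∣ n) {𝔽 : Type} [Field 𝔽] [Algebra (ZMod 2) 𝔽]
    (b : Module.Basis (Fin m) (ZMod 2) 𝔽) (c : Coeffs (r + 1) r t n 𝔽)
    (d : User (r + 1) r → Fin N) : (schemeDelivery b c d).maxLoad = optimalLoad r t := by
  classical
  -- A field has two distinct elements, so its basis is nonempty and the file size is not zero.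
  have hm : m ≠ 0 := by
    rintro rfl
    exact not_subsingleton 𝔽 b.equivFun.toEquiv.subsingleton
  set L : ℕ := r.choose (t + 1) * (n / (r - t) * m) + if t = r then n / r * m else 0 with hL
  have hidx : ∀ h : Fin (r + 1),
      Nat.card (DirectIdx (r + 1) r t n m h ⊕ MixedIdx (r + 1) r t n m h) = L := fun h => by
    rw [Nat.card_sum, card_directIdx hn, card_mixedIdx hr]
  have hsup : (Finset.univ.sup fun h : Fin (r + 1) =>
      max (Nat.card ((schemeDelivery b c d).relayIdx h))
        ((usersOf h).sup fun k : User (r + 1) r =>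
          Nat.card ((schemeDelivery b c d).linkIdx h k))) = L := by
    refine le_antisymm (Finset.sup_le fun h _ => max_le (hidx h).le
      (Finset.sup_le fun k _ => (hidx h).le)) ?_
    refine le_trans ?_ (Finset.le_sup (Finset.mem_univ (0 : Fin (r + 1))))
    exact le_max_of_le_left (hidx 0).ge
  rw [Delivery.maxLoad, hsup, card_bitPos, Nat.choose_succ_self_right]
  have hnm : ((n : ℝ) * m) ≠ 0 := by positivity
  have hchoose : ((r + 1).choose t : ℝ) ≠ 0 := by
    exact_mod_cast (Nat.choose_pos ht).ne'
  rcases lt_trichotomy t r with htr | rfl | htr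
  · have hdvd : r - t ∣ n := (Nat.dvd_factorial (by omega) (Nat.sub_le r t)).trans hn
    have hpos : (0 : ℝ) < (r : ℝ) - t := by
      rw [sub_pos]; exact_mod_cast htr
    have hq : ((n / (r - t) : ℕ) : ℝ) = n / ((r : ℝ) - t) := by
      rw [Nat.cast_div hdvd (by rw [Nat.cast_sub htr.le]; exact hpos.ne'), Nat.cast_sub htr.le]
    have h1 : (r.choose (t + 1) : ℝ) * (t + 1) = r.choose t * (r - t) := by
      rw [← Nat.cast_sub htr.le]
      exact_mod_cast Nat.choose_succ_right_eq r t
    have h2 : ((r : ℝ) + 1) * r.choose t = (r + 1).choose t * (r + 1 - t) := by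
      rw [show ((r : ℝ) + 1 - t) = ((r + 1 - t : ℕ) : ℝ) by
        rw [Nat.cast_sub (by omega)]; push_cast; rfl]
      have := Nat.choose_mul_succ_eq r t
      rw [mul_comm] at this
      exact_mod_cast this
    rw [optimalLoad, min_eq_left (by omega), hL, if_neg htr.ne]
    push_cast
    rw [hq, div_eq_div_iff (by positivity) (by positivity)]
    field_simp
    linear_combination (n : ℝ) * m * (((r : ℝ) + 1) * h1 + ((r : ℝ) - t) * h2)
  · have hq : ((n / t : ℕ) : ℝ) = n / (t : ℝ) :=
      Nat.cast_div ((Nat.dvd_factorial hr le_rfl).trans hn) (by positivity)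
    rw [optimalLoad, min_eq_right (by omega), hL, if_pos rfl, Nat.choose_succ_self,
      Nat.choose_succ_self_right]
    push_cast
    rw [hq]
    field_simp
    ring
  · obtain rfl : t = r + 1 := by omega
    rw [optimalLoad, hL, if_neg htr.ne', Nat.choose_eq_zero_of_lt (by omega)]
    simp

lemma schemeAchieves_optimalLoad {r t : ℕ} (N : ℕ) (hr : 1 ≤ r) (ht : t ≤ r + 1) :
    SchemeAchieves (r + 1) r N t (optimalLoad r t) :=
  fun n hn0 hn => ⟨fun _ _ k => card_manPlacement k,
    fun _ _ _ _ b c d => schemeDelivery_maxLoad hr ht hn0 hn b c d,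
    fun ε hε => exists_le_card_recovers _ _ N t n ((Nat.dvd_factorial hr le_rfl).trans hn) ε hε⟩

/-! The converse: bounds on the load that a delivery needs after a given uncoded placement. -/

/-- The max-link load bounds the number of bits that each relay receives. -/
lemma Delivery.card_relayIdx_le {H r N : ℕ} {β : Type} [Finite β] [Nonempty β]
    {X : Delivery H r N β} {R : ℝ} (hX : X.maxLoad ≤ R) (h : Fin H) :
    (Nat.card (X.relayIdx h) : ℝ) ≤ R * Nat.card β := by
  have hpos : (0 : ℝ) < Nat.card β := by exact_mod_cast Nat.card_pos
  rw [Delivery.maxLoad, div_le_iff₀ hpos] at hX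
  refine le_trans (Nat.cast_le.2 ?_) hX
  exact (le_max_left _ _).trans (Finset.le_sup (f := fun h : Fin H =>
      max (Nat.card (X.relayIdx h))
        ((usersOf h).sup fun k : User H r => Nat.card (X.linkIdx h k))) (Finset.mem_univ h))

/-- The library bits that are demanded by some user of `U` and cached neither by this user nor by
any user of `U` that comes before it. -/
def newBits {H r N : ℕ} {β : Type} (Z : Placement H r N β) (d : User H r → Fin N)
    (U : Finset (User H r)) (rank : User H r → ℕ) : Set (Fin N × β) :=
  {x | ∃ k ∈ U, d k = x.1 ∧ ∀ k' ∈ U, rank k' ≤ rank k → x ∉ Z k'}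

/-- If the users of `U` all decode correctly, then the messages of the relays and the library bits
outside `newBits` determine the library. -/
lemma eq_of_decoded {H r N : ℕ} {β : Type} {Z : Placement H r N β} {X : Delivery H r N β}
    {d : User H r → Fin N} {U : Finset (User H r)} (rank : User H r → ℕ)
    {dec : (k : User H r) → (Z k → ZMod 2) →
      ((h : k.1) → X.linkIdx h.1 k → ZMod 2) → (β → ZMod 2)} {F F' : Files N β}
    (hF : ∀ k ∈ U, dec k (cacheContent Z k F) (X.received k F) = F (d k))
    (hF' : ∀ k ∈ U, dec k (cacheContent Z k F') (X.received k F') = F' (d k))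
    (hmsg : ∀ k ∈ U, ∀ h ∈ k.1, X.server F h = X.server F' h)
    (hout : ∀ x ∉ newBits Z d U rank, F x.1 x.2 = F' x.1 x.2) : F = F' := by
  have hdec : ∀ n : ℕ, ∀ k ∈ U, rank k = n → F (d k) = F' (d k) := by
    intro n
    induction n using Nat.strong_induction_on with
    | _ n ih =>
      rintro k hk rfl
      have hcache : cacheContent Z k F = cacheContent Z k F' := by
        funext x
        -- A bit cached by `k` can only be new for a user of strictly smaller rank, which has
        -- already decoded it; all other bits agree by `hout`.
        by_cases hx : x.1 ∈ newBits Z d U rank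
        · obtain ⟨k', hk', hd, hnot⟩ := hx
          have hlt : rank k' < rank k := by
            by_contra hle
            exact hnot k hk (not_lt.1 hle) x.2
          have := ih _ hlt k' hk' rfl
          rw [hd] at this
          exact congrFun this x.1.2
        · exact hout _ hx
      have hrec : X.received k F = X.received k F' := by
        funext h
        simp only [Delivery.received]
        rw [hmsg k hk h.1 h.2]
      rw [← hF k hk, ← hF' k hk, hcache, hrec]
  funext f p
  by_cases hx : (f, p) ∈ newBits Z d U rank
  · obtain ⟨k, hk, hd, -⟩ := hx
    have := hdec _ k hk rfl
    rw [hd] at this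
    exact congrFun this p
  · exact hout _ hx

/-- The acyclic index coding bound: the relays connected to the users of `U` together receive at
least as many bits as there are in `newBits`. -/
lemma ncard_newBits_le {H r N : ℕ} {β : Type} [Finite β] {Z : Placement H r N β}
    {X : Delivery H r N β} {d : User H r → Fin N} {U : Finset (User H r)}
    (rank : User H r → ℕ) {ε : ℝ} (hε : U.card * ε < 1 / 2)
    (hrec : ∀ k ∈ U, X.Recovers Z k (d k) ε) :
    (newBits Z d U rank).ncard ≤ ∑ h ∈ U.biUnion fun k => k.1, Nat.card (X.relayIdx h) := by
  classical
  have hfin := X.finite_relayIdx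
  set V : Finset (Fin H) := U.biUnion fun k => k.1 with hV
  have hdec : ∀ k, ∃ dec : (Z k → ZMod 2) → ((h : k.1) → X.linkIdx h.1 k → ZMod 2) →
      (β → ZMod 2), k ∈ U → (Nat.card {F : Files N β //
        dec (cacheContent Z k F) (X.received k F) ≠ F (d k)} : ℝ) /
      (Nat.card (Files N β) : ℝ) ≤ ε := fun k => by
    by_cases hk : k ∈ U
    · obtain ⟨dec, h⟩ := hrec k hk
      exact ⟨dec, fun _ => h⟩
    · exact ⟨0, fun h => absurd h hk⟩
  choose dec hdec using hdec
  set good : Files N β → Prop := fun F =>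
    ∀ k ∈ U, dec k (cacheContent Z k F) (X.received k F) = F (d k) with hgood
  have hT : Nat.card (Files N β) = 2 ^ (N * Nat.card β) := by
    simp [Files, Nat.card_fun, ← pow_mul, mul_comm]
  have hTpos : (0 : ℝ) < Nat.card (Files N β) := by rw [hT]; positivity
  have hbad : (Nat.card {F // ¬ good F} : ℝ) ≤ U.card * ε * Nat.card (Files N β) := by
    have h1 : Nat.card {F // ¬ good F} ≤ ∑ k ∈ U, Nat.card {F : Files N β //
        dec k (cacheContent Z k F) (X.received k F) ≠ F (d k)} := by
      have := Fintype.ofFinite (Files N β)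
      simp only [Nat.card_eq_fintype_card, Fintype.card_subtype]
      refine le_trans (Finset.card_le_card fun F hF => ?_) Finset.card_biUnion_le
      have hF' := (Finset.mem_filter.1 hF).2
      simp only [hgood, not_forall] at hF'
      obtain ⟨k, hk, hne⟩ := hF'
      exact Finset.mem_biUnion.2 ⟨k, hk, Finset.mem_filter.2 ⟨Finset.mem_univ _, hne⟩⟩
    refine (Nat.cast_le.2 h1).trans ?_
    rw [Nat.cast_sum, mul_assoc, ← nsmul_eq_mul]
    exact Finset.sum_le_card_nsmul _ _ _ fun k hk => (div_le_iff₀ hTpos).1 (hdec k hk)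
  have hsplit : (Nat.card (Files N β) : ℝ) =
      Nat.card {F // good F} + Nat.card {F // ¬ good F} := by
    rw [← Nat.cast_add, ← Nat.card_sum, Nat.card_congr (Equiv.sumCompl good)]
  set A := newBits Z d U rank with hA
  -- A correctly decoded library is determined by its bits outside `A` and the messages of the
  -- relays in `V`.
  have hinj : Nat.card {F // good F} ≤
      Nat.card (((Aᶜ : Set (Fin N × β)) → ZMod 2) × ((h : V) → X.relayIdx h.1 → ZMod 2)) := by
    refine Nat.card_le_card_of_injective
      (fun F => (fun x => F.1 x.1.1 x.1.2, fun h => X.server F.1 h.1)) fun F F' hFF' => ?_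
    refine Subtype.ext (eq_of_decoded rank F.2 F'.2 (fun k hk h hh => ?_) fun x hx => ?_)
    · exact congrFun (Prod.ext_iff.1 hFF').2 ⟨h, Finset.mem_biUnion.2 ⟨k, hk, hh⟩⟩
    · exact congrFun (Prod.ext_iff.1 hFF').1 ⟨x, hx⟩
  have hcard : Nat.card (((Aᶜ : Set (Fin N × β)) → ZMod 2) ×
      ((h : V) → X.relayIdx h.1 → ZMod 2)) =
      2 ^ (Aᶜ.ncard + ∑ h ∈ V, Nat.card (X.relayIdx h)) := by
    rw [Nat.card_prod, Nat.card_fun, Nat.card_pi, pow_add, ← Finset.prod_pow_eq_pow_sum,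
      ← Finset.prod_coe_sort V]
    simp [Nat.card_fun, Nat.card_coe_set_eq]
  have hcompl : A.ncard + Aᶜ.ncard = N * Nat.card β := by
    rw [Set.ncard_add_ncard_compl]
    simp
  -- More than half of the libraries are decoded correctly. Losing less than a factor 2 costs less
  -- than one bit, so comparing integer exponents gives the bound without any error term.
  have hlt : (2 : ℝ) ^ (N * Nat.card β) <
      2 ^ (Aᶜ.ncard + ∑ h ∈ V, Nat.card (X.relayIdx h) + 1) := by
    rw [hcard] at hinj
    have hinj' : (Nat.card {F // good F} : ℝ) ≤
        2 ^ (Aᶜ.ncard + ∑ h ∈ V, Nat.card (X.relayIdx h)) := by exact_mod_cast hinj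
    have hT' : (Nat.card (Files N β) : ℝ) = 2 ^ (N * Nat.card β) := by rw [hT]; push_cast; rfl
    rw [pow_succ, ← hT']
    nlinarith
  have := (pow_lt_pow_iff_right₀ (by norm_num : (1 : ℝ) < 2)).1 hlt
  omega

/-- The cut-set bound for a single user. -/
lemma UncodedAchievable.single_user_bound {H r N : ℕ} {M R : ℝ}
    (hR : UncodedAchievable H r N M R) (k : User H r) : (N : ℝ) - M ≤ N * (r * R) := by
  classical
  obtain ⟨β, _, _, Z, hZ, hX⟩ := hR (1 / 4) (by norm_num)
  have := Fintype.ofFinite β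
  have hpos : (0 : ℝ) < Nat.card β := by exact_mod_cast Nat.card_pos
  have hfile : ∀ f : Fin N, ((newBits Z (fun _ => f) {k} (fun _ => 0)).ncard : ℝ) ≤
      r * (R * Nat.card β) := by
    intro f
    obtain ⟨X, hload, hrec⟩ := hX fun _ => f
    have h := ncard_newBits_le (U := {k}) (fun _ => 0) (by norm_num) (fun k' _ => hrec k')
    rw [Finset.singleton_biUnion] at h
    refine (Nat.cast_le.2 h).trans ?_
    rw [Nat.cast_sum]
    refine (Finset.sum_le_card_nsmul _ _ _ fun i _ => Delivery.card_relayIdx_le hload i).trans ?_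
    rw [k.2, nsmul_eq_mul]
  -- As the demanded file runs through the library, the new bits partition what `k` does not cache.
  have hcount : ∑ f : Fin N, (newBits Z (fun _ => f) {k} (fun _ => 0)).ncard =
      (Z k)ᶜ.card := by
    have hset : ∀ f, newBits Z (fun _ => f) {k} (fun _ => 0) =
        ((Z k)ᶜ.filter fun x => x.1 = f : Finset (Fin N × β)) := fun f => by
      ext x
      simp [newBits, and_comm, eq_comm]
    simp only [hset, Set.ncard_coe_finset]
    exact (Finset.card_eq_sum_card_fiberwise fun x _ => Finset.mem_univ x.1).symm
  have hsum : (((Z k)ᶜ.card : ℕ) : ℝ) ≤ N * (r * (R * Nat.card β)) := by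
    rw [← hcount, Nat.cast_sum]
    refine (Finset.sum_le_card_nsmul _ _ _ fun f _ => hfile f).trans ?_
    simp
  have hcompl : ((Z k).card : ℝ) + ((Z k)ᶜ.card : ℝ) = N * Nat.card β := by
    rw [← Nat.cast_add, Finset.card_add_card_compl]
    simp
  have hk := hZ k
  have : ((N : ℝ) - M) * Nat.card β ≤ N * (r * R) * Nat.card β := by nlinarith
  exact le_of_mul_le_mul_right this hpos

/-! ### Averaging over decoding orders and demands. -/

/-- Among the bijections with `Fin n`, an element comes before the set `S`, to which it does not
belong, in a fraction `1 / (|S| + 1)` of the cases. -/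
lemma card_equiv_before {α : Type*} [Fintype α] [DecidableEq α] {n : ℕ} (S : Finset α) {a : α}
    (ha : a ∉ S) : (S.card + 1) *
      (Finset.univ.filter fun π : α ≃ Fin n => ∀ b ∈ S, π a < π b).card =
      Fintype.card (α ≃ Fin n) := by
  have hmem : a ∈ insert a S := Finset.mem_insert_self a S
  -- `P v` collects the orders in which `v` comes first in `insert a S`. These classes partition all
  -- orders, and swapping `a` with `v` shows that they have equal size.
  set P : α → Finset (α ≃ Fin n) := fun v =>
    Finset.univ.filter fun π => ∀ b ∈ insert a S, b ≠ v → π v < π b with hP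
  have hPa : (Finset.univ.filter fun π : α ≃ Fin n => ∀ b ∈ S, π a < π b) = P a := by
    ext π
    simp only [hP, Finset.mem_filter, Finset.mem_univ, true_and]
    refine ⟨fun h b hb hba => h b ((Finset.mem_insert.1 hb).resolve_left hba), fun h b hb =>
      h b (Finset.mem_insert_of_mem hb) ?_⟩
    rintro rfl
    exact ha hb
  have hcard : ∀ v ∈ insert a S, (P v).card = (P a).card := by
    intro v hv
    have hswap : ∀ b, b ∈ insert a S → Equiv.swap a v b ∈ insert a S := fun b hb => by
      rw [Equiv.swap_apply_def]
      split_ifs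
      exacts [hv, hmem, hb]
    refine Finset.card_bij' (fun π _ => (Equiv.swap a v).trans π)
      (fun π _ => (Equiv.swap a v).trans π) ?_ ?_ ?_ ?_
    · intro π hπ
      simp only [hP, Finset.mem_filter, Finset.mem_univ, true_and] at hπ ⊢
      intro b hb hba
      simp only [Equiv.trans_apply, Equiv.swap_apply_left]
      refine hπ _ (hswap b hb) fun h => hba ?_
      rw [← (Equiv.swap a v).injective.eq_iff, h, Equiv.swap_apply_left]
    · intro π hπ
      simp only [hP, Finset.mem_filter, Finset.mem_univ, true_and] at hπ ⊢
      intro b hb hbv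
      simp only [Equiv.trans_apply, Equiv.swap_apply_right]
      refine hπ _ (hswap b hb) fun h => hbv ?_
      rw [← (Equiv.swap a v).injective.eq_iff, h, Equiv.swap_apply_right]
    all_goals
      intro π _
      ext b
      simp
  have hdisj : ((insert a S : Finset α) : Set α).PairwiseDisjoint P := by
    intro v hv w hw hvw
    refine Finset.disjoint_left.2 fun π h1 h2 => ?_
    simp only [hP, Finset.mem_filter, Finset.mem_univ, true_and] at h1 h2
    exact lt_asymm (h1 w hw hvw.symm) (h2 v hv hvw)
  have hunion : (insert a S).biUnion P = Finset.univ := by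
    refine Finset.eq_univ_of_forall fun π => ?_
    obtain ⟨v, hv, hmin⟩ := Finset.exists_min_image (insert a S) π ⟨a, hmem⟩
    refine Finset.mem_biUnion.2 ⟨v, hv, Finset.mem_filter.2 ⟨Finset.mem_univ _, fun b hb hbv => ?_⟩⟩
    exact lt_of_le_of_ne (hmin b hb) fun h => hbv (π.injective h).symm
  rw [hPa, ← Finset.card_univ, ← hunion, Finset.card_biUnion hdisj, Finset.sum_congr rfl hcard,
    Finset.sum_const, Finset.card_insert_of_notMem ha, smul_eq_mul]

/-- The mean number of elements that come before the set `S`. -/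
lemma sum_card_before {α : Type*} [Fintype α] [DecidableEq α] {n : ℕ} (S : Finset α) :
    ∑ π : α ≃ Fin n, ((Finset.univ.filter fun a => ∀ b ∈ S, π a < π b).card : ℝ) =
      Fintype.card (α ≃ Fin n) * (((Fintype.card α : ℝ) - S.card) / (S.card + 1)) := by
  have h1 : ∑ π : α ≃ Fin n, (Finset.univ.filter fun a => ∀ b ∈ S, π a < π b).card =
      ∑ a : α, (Finset.univ.filter fun π : α ≃ Fin n => ∀ b ∈ S, π a < π b).card := by
    simp only [Finset.card_filter]
    exact Finset.sum_comm
  have h2 : ∑ a : α, (Finset.univ.filter fun π : α ≃ Fin n => ∀ b ∈ S, π a < π b).card =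
      ∑ a ∈ Sᶜ, (Finset.univ.filter fun π : α ≃ Fin n => ∀ b ∈ S, π a < π b).card := by
    refine (Finset.sum_subset (Finset.subset_univ _) fun a _ ha => ?_).symm
    rw [Finset.mem_compl, not_not] at ha
    refine Finset.card_eq_zero.2 (Finset.filter_eq_empty_iff.2 fun π _ h => ?_)
    exact lt_irrefl _ (h a ha)
  have h3 : ∀ a ∈ Sᶜ, ((Finset.univ.filter fun π : α ≃ Fin n => ∀ b ∈ S, π a < π b).card : ℝ) =
      Fintype.card (α ≃ Fin n) / ((S.card : ℝ) + 1) := fun a ha => by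
    rw [eq_div_iff (by positivity), mul_comm]
    exact_mod_cast card_equiv_before S (Finset.mem_compl.1 ha)
  rw [← Nat.cast_sum, h1, h2, Nat.cast_sum, Finset.sum_congr rfl h3, Finset.sum_const,
    Finset.card_compl, nsmul_eq_mul, Nat.cast_sub (Finset.card_le_univ S)]
  ring

/-- The bound for all users, with the library bits weighted by the number of users that cache
them. -/
lemma sum_cached_le {H r N : ℕ} {β : Type} [Fintype β] [DecidableEq β] [Nonempty β]
    {Z : Placement H r N β}
    {R ε : ℝ} (hN : H.choose r ≤ N) (hN0 : 0 < N) (hε : H.choose r * ε < 1 / 2)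
    (hX : ∀ d : User H r → Fin N, ∃ X : Delivery H r N β,
      X.maxLoad ≤ R ∧ ∀ k, X.Recovers Z k (d k) ε) :
    ∑ x : Fin N × β, (((H.choose r : ℕ) : ℝ) - (Finset.univ.filter fun k => x ∈ Z k).card) /
        ((Finset.univ.filter fun k => x ∈ Z k).card + 1) ≤
      N * (H * (R * Nat.card β)) := by
  classical
  have : NeZero N := ⟨hN0.ne'⟩
  set K := H.choose r with hK
  have e : User H r ≃ Fin K := Fintype.equivFinOfCardEq (card_user H r)
  -- As `K ≤ N`, the users can demand distinct files; the shifts `ι k + s` modulo `N` make each user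
  -- demand every file exactly once.
  set ι : User H r → Fin N := fun k => Fin.castLE hN (e k) with hι
  have hιinj : Function.Injective ι := (Fin.castLE_injective hN).comp e.injective
  have hbound : ∀ (π : User H r ≃ Fin K) (s : Fin N),
      ((newBits Z (fun k => ι k + s) Finset.univ (fun k => (π k).1)).ncard : ℝ) ≤
        H * (R * Nat.card β) := by
    intro π s
    obtain ⟨X, hload, hrec⟩ := hX fun k => ι k + s
    have h := ncard_newBits_le (U := Finset.univ) (fun k => (π k).1)
      (by rw [Finset.card_univ, card_user]; exact hε) (fun k _ => hrec k)
    refine (Nat.cast_le.2 (h.trans (Finset.sum_le_sum_of_subset (Finset.subset_univ _)))).trans ?_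
    rw [Nat.cast_sum]
    refine (Finset.sum_le_card_nsmul _ _ _ fun i _ => Delivery.card_relayIdx_le hload i).trans ?_
    simp
  have hcount : ∀ π : User H r ≃ Fin K,
      ∑ s : Fin N, (newBits Z (fun k => ι k + s) Finset.univ (fun k => (π k).1)).ncard =
      ∑ x : Fin N × β, (Finset.univ.filter fun k => ∀ b ∈ Finset.univ.filter fun k => x ∈ Z k,
        π k < π b).card := by
    intro π
    have hset : ∀ s, (newBits Z (fun k => ι k + s) Finset.univ (fun k => (π k).1)).ncard =
        ((Finset.univ : Finset (Fin N × β)).filter fun x =>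
          x ∈ newBits Z (fun k => ι k + s) Finset.univ (fun k => (π k).1)).card := fun s => by
      rw [← Set.ncard_coe_finset]
      simp
    simp only [hset, Finset.card_filter]
    rw [Finset.sum_comm]
    refine Finset.sum_congr rfl fun x _ => ?_
    rw [← Finset.card_filter, ← Finset.card_filter]
    symm
    -- User `k` demands the file of `x` for the single shift `x.1 - ι k`, and different users do so
    -- for different shifts. So shifts at which `x` is new correspond to users that precede all
    -- those caching `x`.
    refine Finset.card_bij (fun k _ => x.1 - ι k) ?_ ?_ ?_
    · intro k hk
      refine Finset.mem_filter.2 ⟨Finset.mem_univ _, k, Finset.mem_univ _, add_sub_cancel _ _, ?_⟩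
      intro k' _ hle hx
      exact absurd ((Finset.mem_filter.1 hk).2 k' (by simpa using hx)) (not_lt.2 hle)
    · intro k _ k' _ h
      exact hιinj (sub_right_injective h)
    · intro s hs
      obtain ⟨k, -, hd, hnot⟩ := (Finset.mem_filter.1 hs).2
      refine ⟨k, Finset.mem_filter.2 ⟨Finset.mem_univ _, fun b hb => ?_⟩, ?_⟩
      · by_contra hlt
        exact hnot b (Finset.mem_univ _) (not_lt.1 hlt) (Finset.mem_filter.1 hb).2
      · rw [← hd]
        exact add_sub_cancel_left _ _
  have hsum : ∑ π : User H r ≃ Fin K, ∑ x : Fin N × β,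
      ((Finset.univ.filter fun k => ∀ b ∈ Finset.univ.filter fun k => x ∈ Z k,
        π k < π b).card : ℝ) ≤
      Fintype.card (User H r ≃ Fin K) * (N * (H * (R * Nat.card β))) := by
    rw [← nsmul_eq_mul]
    refine Finset.sum_le_card_nsmul _ _ _ fun π _ => ?_
    rw [← Nat.cast_sum, ← hcount, Nat.cast_sum]
    refine (Finset.sum_le_card_nsmul _ _ _ fun s _ => hbound π s).trans ?_
    simp
  rw [Finset.sum_comm] at hsum
  simp only [sum_card_before, ← Finset.mul_sum, card_user] at hsum
  refine le_of_mul_le_mul_left hsum ?_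
  exact_mod_cast Fintype.card_pos_iff.2 ⟨e⟩

/-- The chords of the convex function `s ↦ (K - s) / (s + 1)` between consecutive natural numbers
lie below its values at the natural numbers. -/
lemma chord_le {K : ℝ} (hK : 0 ≤ K) (t s : ℕ) :
    (K + 1) * (2 * t + 2 - s) / (((t : ℝ) + 1) * (t + 2)) - 1 ≤ (K - s) / (s + 1) := by
  have hs : (K - s) / ((s : ℝ) + 1) = (K + 1) / (s + 1) - 1 := by field_simp; ring
  rw [hs, sub_le_sub_iff_right, div_le_div_iff₀ (by positivity) (by positivity)]
  -- After clearing denominators, the claim is `(s - t) * (s - t - 1) ≥ 0`, which holds because no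
  -- integer lies strictly between `t` and `t + 1`.
  have h : (0 : ℝ) ≤ ((s : ℝ) - t) * (s - t - 1) := by
    rcases le_or_gt s t with h | h
    · have : (s : ℝ) ≤ t := by exact_mod_cast h
      nlinarith
    · have : (t : ℝ) + 1 ≤ s := by exact_mod_cast h
      nlinarith
  nlinarith [mul_nonneg (by linarith : (0 : ℝ) ≤ K + 1) h]

/-- The bound for all users. -/
lemma UncodedAchievable.all_users_bound {H r N : ℕ} {M R : ℝ}
    (hR : UncodedAchievable H r N M R) (hN : H.choose r ≤ N) (hN0 : 0 < N) (t : ℕ) :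
    (((H.choose r : ℕ) : ℝ) + 1) * (2 * t + 2 - M * (H.choose r : ℕ) / N) /
      (((t : ℝ) + 1) * (t + 2)) - 1 ≤ H * R := by
  classical
  -- This tolerance keeps the total error of the `K` users below `1 / 2`.
  obtain ⟨β, _, _, Z, hZ, hX⟩ := hR (1 / (2 * ((H.choose r : ℕ) + 1))) (by positivity)
  have := Fintype.ofFinite β
  set K := H.choose r with hK
  have hpos : (0 : ℝ) < Nat.card β := by exact_mod_cast Nat.card_pos
  have hNpos : (0 : ℝ) < N := by exact_mod_cast hN0
  have h1 := sum_cached_le hN hN0 (by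
    rw [mul_one_div, div_lt_div_iff₀ (by positivity) (by positivity)]; linarith) hX
  have h2 := (Finset.sum_le_sum fun (x : Fin N × β) (_ : x ∈ Finset.univ) =>
    chord_le (Nat.cast_nonneg K) t (Finset.univ.filter fun k => x ∈ Z k).card).trans h1
  -- Double counting bounds the sum of the multiplicities `s` by the total memory; the chord
  -- decreases in `s`, so inserting this upper bound weakens the inequality in the right direction.
  have hsum : ∑ x : Fin N × β, ((Finset.univ.filter fun k => x ∈ Z k).card : ℝ) ≤
      K * (M * Nat.card β) := by
    have : ∑ x : Fin N × β, (Finset.univ.filter fun k => x ∈ Z k).card =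
        ∑ k, (Z k).card := by
      simp only [Finset.card_filter]
      rw [Finset.sum_comm]
      simp
    rw [← Nat.cast_sum, this, Nat.cast_sum]
    refine (Finset.sum_le_card_nsmul _ _ _ fun k _ => hZ k).trans ?_
    rw [Finset.card_univ, card_user, nsmul_eq_mul]
  rw [Finset.sum_sub_distrib, ← Finset.sum_div, ← Finset.mul_sum, Finset.sum_sub_distrib,
    Finset.sum_const, Finset.sum_const, Finset.card_univ, Fintype.card_prod, Fintype.card_fin,
    ← Nat.card_eq_fintype_card, nsmul_eq_mul, nsmul_eq_mul] at h2
  push_cast at h2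
  set D : ℝ := ((t : ℝ) + 1) * (t + 2) with hD
  have hDpos : 0 < D := by positivity
  have h3 : ((K : ℝ) + 1) * (N * Nat.card β * (2 * t + 2) - K * (M * Nat.card β)) / D -
      N * Nat.card β * 1 ≤ N * (H * (R * Nat.card β)) := by
    refine le_trans ?_ h2
    gcongr
  have h4 : ((K : ℝ) + 1) * (N * Nat.card β * (2 * t + 2) - K * (M * Nat.card β)) / D -
      N * Nat.card β * 1 = (N * Nat.card β) *
      (((K : ℝ) + 1) * (2 * t + 2 - M * K / N) / D - 1) := by
    field_simp
  rw [h4] at h3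
  refine le_of_mul_le_mul_left (a := (N : ℝ) * Nat.card β) ?_ (by positivity)
  linarith

/-! Memory sharing. -/

/-- There is an uncoded placement of files of `B` bits with at most `C` bits in each cache that
allows, for all demands, a delivery without errors with at most `L` bits on each link. -/
def ZeroErrorScheme (H r N B : ℕ) (C L : ℝ) : Prop :=
  ∃ (β : Type) (_ : Finite β) (Z : Placement H r N β), Nat.card β = B ∧
    (∀ k, ((Z k).card : ℝ) ≤ C) ∧
    ∀ d : User H r → Fin N, ∃ X : Delivery H r N β,
      (∀ h, (Nat.card (X.relayIdx h) : ℝ) ≤ L) ∧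
      (∀ h, ∀ k ∈ usersOf h, (Nat.card (X.linkIdx h k) : ℝ) ≤ L) ∧
      ∀ k, X.Recovers Z k (d k) 0

lemma ZeroErrorScheme.zero (H r N : ℕ) : ZeroErrorScheme H r N 0 0 0 := by
  refine ⟨Empty, inferInstance, fun _ => ∅, by simp, by simp, fun d => ?_⟩
  refine ⟨⟨fun _ => Empty, fun _ _ => Empty, fun _ => inferInstance, fun _ _ => inferInstance,
    fun _ _ => Empty.elim, fun _ _ _ => Empty.elim⟩, by simp, by simp, fun k => ?_⟩
  exact recovers_zero_of_determined fun F F' _ _ => funext fun p => p.elim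

/-- The deliveries for two parts of the files, used together. -/
def Delivery.sum {H r N : ℕ} {β β' : Type} (X : Delivery H r N β) (X' : Delivery H r N β') :
    Delivery H r N (β ⊕ β') where
  relayIdx h := X.relayIdx h ⊕ X'.relayIdx h
  linkIdx h k := X.linkIdx h k ⊕ X'.linkIdx h k
  finite_relayIdx h := by
    have := X.finite_relayIdx h
    have := X'.finite_relayIdx h
    infer_instance
  finite_linkIdx h k := by
    have := X.finite_linkIdx h k
    have := X'.finite_linkIdx h k
    infer_instance
  server F h := Sum.elim (X.server (fun i p => F i (Sum.inl p)) h)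
    (X'.server (fun i p => F i (Sum.inr p)) h)
  relay h k y := Sum.elim (X.relay h k fun a => y (Sum.inl a)) (X'.relay h k fun a => y (Sum.inr a))

/-- Each file is cut into two parts that are cached and delivered independently, so file sizes,
cache budgets and link budgets add. -/
lemma ZeroErrorScheme.add {H r N B B' : ℕ} {C C' L L' : ℝ} (h : ZeroErrorScheme H r N B C L)
    (h' : ZeroErrorScheme H r N B' C' L') :
    ZeroErrorScheme H r N (B + B') (C + C') (L + L') := by
  classical
  obtain ⟨β, _, Z, hB, hZ, hX⟩ := h
  obtain ⟨β', _, Z', hB', hZ', hX'⟩ := h'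
  refine ⟨β ⊕ β', inferInstance, fun k => (Z k).image (fun x => (x.1, Sum.inl x.2)) ∪
    (Z' k).image (fun x => (x.1, Sum.inr x.2)), by rw [Nat.card_sum, hB, hB'], fun k => ?_,
    fun d => ?_⟩
  · refine (Nat.cast_le.2 ((Finset.card_union_le _ _).trans
      (add_le_add Finset.card_image_le Finset.card_image_le))).trans ?_
    rw [Nat.cast_add]
    exact add_le_add (hZ k) (hZ' k)
  obtain ⟨X, hr, hl, hrec⟩ := hX d
  obtain ⟨X', hr', hl', hrec'⟩ := hX' d
  refine ⟨X.sum X', fun h => ?_, fun h k hk => ?_, fun k => ?_⟩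
  · have := X.finite_relayIdx h
    have := X'.finite_relayIdx h
    change ((Nat.card (X.relayIdx h ⊕ X'.relayIdx h) : ℕ) : ℝ) ≤ _
    rw [Nat.card_sum, Nat.cast_add]
    exact add_le_add (hr h) (hr' h)
  · have := X.finite_linkIdx h k
    have := X'.finite_linkIdx h k
    change ((Nat.card (X.linkIdx h k ⊕ X'.linkIdx h k) : ℕ) : ℝ) ≤ _
    rw [Nat.card_sum, Nat.cast_add]
    exact add_le_add (hl h k hk) (hl' h k hk)
  obtain ⟨dec, hdec⟩ := (hrec k).exists_decoder
  obtain ⟨dec', hdec'⟩ := (hrec' k).exists_decoder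
  refine recovers_zero_of_determined fun F F' hc hm => ?_
  have hm1 : X.received k (fun i p => F i (Sum.inl p)) =
      X.received k (fun i p => F' i (Sum.inl p)) :=
    funext fun h => funext fun a => congrFun (congrFun hm h) (Sum.inl a)
  have hm2 : X'.received k (fun i p => F i (Sum.inr p)) =
      X'.received k (fun i p => F' i (Sum.inr p)) :=
    funext fun h => funext fun a => congrFun (congrFun hm h) (Sum.inr a)
  have hc1 : cacheContent Z k (fun i p => F i (Sum.inl p)) =
      cacheContent Z k (fun i p => F' i (Sum.inl p)) :=
    funext fun x => congrFun hc ⟨(x.1.1, Sum.inl x.1.2),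
      Finset.mem_union_left _ (Finset.mem_image_of_mem _ x.2)⟩
  have hc2 : cacheContent Z' k (fun i p => F i (Sum.inr p)) =
      cacheContent Z' k (fun i p => F' i (Sum.inr p)) :=
    funext fun x => congrFun hc ⟨(x.1.1, Sum.inr x.1.2),
      Finset.mem_union_right _ (Finset.mem_image_of_mem _ x.2)⟩
  funext p
  rcases p with p | p
  · have h1 := hdec (fun i p => F i (Sum.inl p))
    rw [hc1, hm1, hdec] at h1
    exact (congrFun h1 p).symm
  · have h1 := hdec' (fun i p => F i (Sum.inr p))
    rw [hc2, hm2, hdec'] at h1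
    exact (congrFun h1 p).symm

lemma ZeroErrorScheme.mul {H r N B : ℕ} {C L : ℝ} (h : ZeroErrorScheme H r N B C L) (p : ℕ) :
    ZeroErrorScheme H r N (p * B) (p * C) (p * L) := by
  induction p with
  | zero => simpa using ZeroErrorScheme.zero H r N
  | succ p ih =>
    have := ih.add h
    rw [Nat.succ_mul, Nat.cast_succ, add_one_mul, add_one_mul]
    exact this

lemma ZeroErrorScheme.uncodedAchievable {H r N B : ℕ} {C L M R : ℝ}
    (h : ZeroErrorScheme H r N B C L) (hB : 0 < B) (hC : C ≤ M * B) (hL : L ≤ R * B)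
    (hR : 0 ≤ R) : UncodedAchievable H r N M R := by
  intro ε hε
  obtain ⟨β, _, Z, rfl, hZ, hX⟩ := h
  refine ⟨β, inferInstance, (Nat.card_pos_iff.1 hB).1, Z, fun k => (hZ k).trans hC, fun d => ?_⟩
  obtain ⟨X, hr, hl, hrec⟩ := hX d
  refine ⟨X, ?_, fun k => ?_⟩
  · have hpos : (0 : ℝ) < Nat.card β := by exact_mod_cast hB
    rw [Delivery.maxLoad, div_le_iff₀ hpos]
    -- The supremum is a natural number, so the real bound passes through its floor; `0 ≤ R` is what
    -- allows the return from the floor.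
    refine (Nat.cast_le.2 (Finset.sup_le fun h _ => max_le (Nat.le_floor ((hr h).trans hL))
      (Finset.sup_le fun k hk => Nat.le_floor ((hl h k hk).trans hL)))).trans
      (Nat.floor_le (by positivity))
  · obtain ⟨dec, hdec⟩ := hrec k
    exact ⟨dec, hdec.trans hε.le⟩

/-- Some choice of the coefficients of a working scheme allows decoding without errors. -/
lemma SchemeAchieves.zeroErrorScheme {H r N t : ℕ} {ρ : ℝ} (h : SchemeAchieves H r N t ρ)
    (ht : t ≤ H.choose r) :
    ∃ B : ℕ, 0 < B ∧
      ZeroErrorScheme H r N B ((t : ℝ) * N / (H.choose r : ℝ) * B) (ρ * B) := by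
  classical
  obtain ⟨hcache, hload, hprob⟩ := h (r !) (Nat.factorial_pos r) dvd_rfl
  -- Success probability at least `1 / 2` already yields one good family of coefficients. The field
  -- used has `2 ^ (m₀ + 1)` elements, so that the exponent is never zero.
  obtain ⟨m₀, hm₀⟩ := hprob (1 / 2) (by norm_num)
  have : Fact (Nat.Prime 2) := ⟨Nat.prime_two⟩
  have hfin : Module.finrank (ZMod 2) (GaloisField 2 (m₀ + 1)) = m₀ + 1 :=
    GaloisField.finrank 2 (Nat.succ_ne_zero m₀)
  let b := Module.finBasisOfFinrankEq (ZMod 2) (GaloisField 2 (m₀ + 1)) hfin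
  have hgood := hm₀ (m₀ + 1) (Nat.le_succ _) (GaloisField 2 (m₀ + 1)) b
  have hpos : 0 < Nat.card (Coeffs H r t (r !) (GaloisField 2 (m₀ + 1))) :=
    Nat.card_pos_iff.2 ⟨⟨fun _ _ _ _ => 0⟩, inferInstance⟩
  have hpos' : (0 : ℝ) < Nat.card (Coeffs H r t (r !) (GaloisField 2 (m₀ + 1))) := by
    exact_mod_cast hpos
  have hgood' := (mul_pos (by norm_num) hpos').trans_le hgood
  obtain ⟨⟨⟨c, hc⟩⟩, -⟩ := Nat.card_pos_iff.1 (Nat.cast_pos.1 hgood')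
  have hB : 0 < Nat.card (BitPos H r t (r !) (m₀ + 1)) := by
    rw [card_bitPos]
    exact Nat.mul_pos (Nat.choose_pos ht) (Nat.mul_pos (Nat.factorial_pos r) (Nat.succ_pos m₀))
  have hBpos : (0 : ℝ) < Nat.card (BitPos H r t (r !) (m₀ + 1)) := by exact_mod_cast hB
  refine ⟨_, hB, BitPos H r t (r !) (m₀ + 1), inferInstance, manPlacement H r N t _ _, rfl,
    fun k => (hcache _ (Nat.succ_pos m₀) k).le, fun d => ⟨schemeDelivery b c d, ?_, ?_, hc d⟩⟩
  · intro h
    have : Nonempty (BitPos H r t (r !) (m₀ + 1)) := (Nat.card_pos_iff.1 hB).1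
    exact Delivery.card_relayIdx_le (hload _ _ b c d).le h
  · intro h k _
    have : Nonempty (BitPos H r t (r !) (m₀ + 1)) := (Nat.card_pos_iff.1 hB).1
    exact Delivery.card_relayIdx_le (hload _ _ b c d).le h

/-- Memory sharing between two schemes. -/
lemma uncodedAchievable_of_lt {H r N B B' : ℕ} {M M' ρ ρ' θ R : ℝ} (hB : 0 < B) (hB' : 0 < B')
    (h : ZeroErrorScheme H r N B (M * B) (ρ * B))
    (h' : ZeroErrorScheme H r N B' (M' * B') (ρ' * B')) (hM : M ≤ M')
    (hθ0 : 0 ≤ θ) (hθ1 : θ < 1) (hR0 : 0 ≤ R) (hR : (1 - θ) * ρ + θ * ρ' < R) :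
    UncodedAchievable H r N ((1 - θ) * M + θ * M') R := by
  -- File sizes are integers, so `θ` is replaced by a rational. It is rounded down so that the
  -- memory does not grow, as `M ≤ M'`; the strict slack in `R` absorbs the change of load.
  obtain ⟨q, hq0, hqθ, hq⟩ : ∃ q : ℚ, 0 ≤ q ∧ (q : ℝ) ≤ θ ∧ (1 - q) * ρ + q * ρ' ≤ R := by
    rcases hθ0.eq_or_lt with rfl | hθ
    · exact ⟨0, le_rfl, by simp, by simpa using hR.le⟩
    · have hcont : Continuous fun x : ℝ => (1 - x) * ρ + x * ρ' := by fun_prop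
      obtain ⟨δ, hδ, hδR⟩ := Metric.continuous_iff.1 hcont θ (R - ((1 - θ) * ρ + θ * ρ'))
        (sub_pos.2 hR)
      obtain ⟨q, hq1, hq2⟩ := exists_rat_btwn (max_lt hθ (sub_lt_self θ hδ))
      obtain ⟨hq0, hq1⟩ := max_lt_iff.1 hq1
      refine ⟨q, by exact_mod_cast hq0.le, hq2.le, ?_⟩
      have := hδR q (by rw [Real.dist_eq, abs_lt]; constructor <;> linarith)
      rw [Real.dist_eq, abs_lt] at this
      linarith [this.2]
  have hq1 : (q : ℝ) ≤ 1 := hqθ.trans hθ1.le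
  set a : ℕ := q.num.toNat with ha
  set b : ℕ := q.den with hb
  have hbpos : (0 : ℝ) < b := by exact_mod_cast q.den_pos
  have haq : (a : ℝ) = q * b := by
    have h1 : ((a : ℤ) : ℝ) = q.num := by rw [ha, Int.toNat_of_nonneg (Rat.num_nonneg.2 hq0)]
    rw [Int.cast_natCast] at h1
    rw [h1]
    have := Rat.mul_den_eq_num q
    exact_mod_cast this.symm
  have hab : a ≤ b := by
    have : (a : ℝ) ≤ b := by rw [haq]; nlinarith
    exact_mod_cast this
  -- With `q = a / b`, these multiplicities give parts of `(b - a) * B * B'` and `a * B * B'` bits,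
  -- in the proportion `1 - q` to `q`.
  have hsum := (h.mul ((b - a) * B')).add (h'.mul (a * B))
  have hBpos : (0 : ℝ) < B := by exact_mod_cast hB
  have hBpos' : (0 : ℝ) < B' := by exact_mod_cast hB'
  have hsize : (b - a) * B' * B + a * B * B' = b * (B * B') := by
    obtain ⟨e, he⟩ := Nat.exists_eq_add_of_le hab
    rw [he, Nat.add_sub_cancel_left]
    ring
  have hcast : ((((b - a) * B' : ℕ)) : ℝ) = b * (1 - q) * B' := by
    rw [Nat.cast_mul, Nat.cast_sub hab, haq]; ring
  rw [hsize, hcast] at hsum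
  have hD : (0 : ℝ) < b * (B * B') := by positivity
  refine hsum.uncodedAchievable (Nat.mul_pos q.den_pos (Nat.mul_pos hB hB')) ?_ ?_ hR0
  · push_cast
    rw [haq]
    nlinarith [mul_le_mul_of_nonneg_left
      (mul_le_mul_of_nonneg_right hqθ (sub_nonneg.2 hM)) hD.le]
  · push_cast
    rw [haq]
    nlinarith [mul_le_mul_of_nonneg_left hq hD.le]

/-! The optimal load and the cut-set bound for `r + 1` relays. -/

/-- The value at the cache size `M = s * N / (r + 1)` of the cut-set curve for `r` relays. -/
noncomputable def singleUserLine (r : ℕ) (s : ℝ) : ℝ :=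
  ((r : ℝ) + 1 - s) / (((r : ℝ) + 1) * r)

/-- The line that agrees with the cut-set curve for all relays at the cache sizes
`M = s * N / (r + 1)` with `t ≤ s ≤ t + 1`. -/
noncomputable def allUsersLine (r t : ℕ) (s : ℝ) : ℝ :=
  (((r : ℝ) + 2) * (2 * t + 2 - s) / (((t : ℝ) + 1) * (t + 2)) - 1) / ((r : ℝ) + 1)

/-- The linear interpolation of the loads `optimalLoad r t` and `optimalLoad r (t + 1)`. -/
noncomputable def interpolatedLoad (r t : ℕ) (l : ℝ) : ℝ :=
  (1 - l) * optimalLoad r t + l * optimalLoad r (t + 1)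

lemma singleUserLine_le_optimalLoad {r j : ℕ} (hr : 1 ≤ r) (hj : j ≤ r + 1) :
    singleUserLine r j ≤ optimalLoad r j := by
  have h1 : (j : ℝ) ≤ r + 1 := by exact_mod_cast hj
  have h2 : 0 < min (j + 1) r := by omega
  have h3 : ((min (j + 1) r : ℕ) : ℝ) ≤ r := by exact_mod_cast min_le_right _ _
  have h4 : (0 : ℝ) < (min (j + 1) r : ℕ) := by exact_mod_cast h2
  unfold singleUserLine optimalLoad
  gcongr

/-- This is `chord_le` for `K = r + 1`, followed by replacing `j + 1` in the denominator by the
smaller `min (j + 1) r`. -/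
lemma allUsersLine_le_optimalLoad {r j : ℕ} (hr : 1 ≤ r) (hj : j ≤ r + 1) (t : ℕ) :
    allUsersLine r t j ≤ optimalLoad r j := by
  have h1 : (j : ℝ) ≤ r + 1 := by exact_mod_cast hj
  have h2 : 0 < min (j + 1) r := by omega
  have h3 : ((min (j + 1) r : ℕ) : ℝ) ≤ j + 1 := by exact_mod_cast min_le_left _ _
  have h4 : (0 : ℝ) < (min (j + 1) r : ℕ) := by exact_mod_cast h2
  have h5 := chord_le (by positivity : (0 : ℝ) ≤ (r : ℝ) + 1) t j
  rw [show (r : ℝ) + 1 + 1 = r + 2 by ring] at h5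
  unfold allUsersLine optimalLoad
  rw [mul_comm ((r : ℝ) + 1) (min (j + 1) r : ℕ), ← div_div _ ((min (j + 1) r : ℕ) : ℝ)]
  refine div_le_div_of_nonneg_right (h5.trans ?_)
    (by positivity : (0 : ℝ) ≤ (r : ℝ) + 1)
  exact div_le_div_of_nonneg_left (by linarith) h4 h3

/-- The line is affine, so the comparison at two consecutive operating points interpolates. At `t =
r + 1` there is no next point, and `l = 0` removes it. -/
lemma singleUserLine_le_interpolatedLoad {r t : ℕ} {l : ℝ} (hr : 1 ≤ r) (ht : t ≤ r + 1)
    (hl0 : 0 ≤ l) (hl1 : l < 1) (hl : t = r + 1 → l = 0) :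
    singleUserLine r (t + l) ≤ interpolatedLoad r t l := by
  have h1 := mul_le_mul_of_nonneg_left (singleUserLine_le_optimalLoad hr ht)
    (sub_nonneg.2 hl1.le)
  have h2 : l * singleUserLine r (t + 1 : ℕ) ≤ l * optimalLoad r (t + 1) := by
    rcases ht.eq_or_lt with h | h
    · rw [hl h, zero_mul, zero_mul]
    · exact mul_le_mul_of_nonneg_left (singleUserLine_le_optimalLoad hr h) hl0
  refine le_trans (le_of_eq ?_) (add_le_add h1 h2)
  unfold singleUserLine
  push_cast
  ring

lemma allUsersLine_le_interpolatedLoad {r t : ℕ} {l : ℝ} (hr : 1 ≤ r) (ht : t ≤ r + 1)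
    (hl0 : 0 ≤ l) (hl1 : l < 1) (hl : t = r + 1 → l = 0) (j : ℕ) :
    allUsersLine r j (t + l) ≤ interpolatedLoad r t l := by
  have h1 := mul_le_mul_of_nonneg_left (allUsersLine_le_optimalLoad hr ht j)
    (sub_nonneg.2 hl1.le)
  have h2 : l * allUsersLine r j (t + 1 : ℕ) ≤ l * optimalLoad r (t + 1) := by
    rcases ht.eq_or_lt with h | h
    · rw [hl h, zero_mul, zero_mul]
    · exact mul_le_mul_of_nonneg_left (allUsersLine_le_optimalLoad hr h j) hl0
  refine le_trans (le_of_eq ?_) (add_le_add h1 h2)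
  unfold allUsersLine
  push_cast
  ring

/-- At both endpoints the minimum is its first argument, so the segment is a chord of `(K - s) / (s
+ 1)` divided by `H`. -/
lemma interpolatedLoad_eq_allUsersLine {r t : ℕ} (ht : t + 1 < r) (l : ℝ) :
    interpolatedLoad r t l = allUsersLine r t (t + l) := by
  unfold interpolatedLoad optimalLoad allUsersLine
  rw [min_eq_left ht.le, min_eq_left (by omega : t + 1 + 1 ≤ r)]
  push_cast
  field_simp
  ring

/-- At both endpoints the minimum is `r`, so the load is affine there. -/
lemma interpolatedLoad_eq_singleUserLine {r t : ℕ} (ht : r ≤ t + 1) (l : ℝ) :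
    interpolatedLoad r t l = singleUserLine r (t + l) := by
  unfold interpolatedLoad optimalLoad singleUserLine
  rw [min_eq_right ht, min_eq_right (by omega : r ≤ t + 1 + 1)]
  push_cast
  ring

lemma cutSetCurve_self {N r : ℕ} {M : ℝ} (hN : 0 < N) (hM0 : 0 ≤ M) (hMN : M ≤ N) :
    cutSetCurve N r r M = (1 - M / N) / r := by
  have hN' : (0 : ℝ) < N := by exact_mod_cast hN
  unfold cutSetCurve cutSetPoint
  simp only [Nat.choose_self, Nat.cast_one, mul_one]
  -- At `M = N` the floor in the curve jumps from 0 to 1.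
  rcases hMN.eq_or_lt with rfl | hlt
  · simp [div_self hN'.ne']
  · rw [Nat.floor_eq_zero.2 ((div_lt_one hN').2 hlt)]
    simp [div_eq_mul_inv]

lemma cutSetCurve_succ {N r t : ℕ} {l : ℝ} (hN : 0 < N) (hl0 : 0 ≤ l) (hl1 : l < 1) :
    cutSetCurve N r (r + 1) ((t + l) * N / ((r : ℝ) + 1)) = allUsersLine r t (t + l) := by
  have hN' : (N : ℝ) ≠ 0 := by positivity
  have hs : ((t : ℝ) + l) * N / ((r : ℝ) + 1) * ((r : ℝ) + 1) / N = t + l := by field_simp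
  have hfloor : ⌊(t : ℝ) + l⌋₊ = t := (Nat.floor_eq_iff (by positivity)).2 ⟨by linarith, by linarith⟩
  unfold cutSetCurve cutSetPoint allUsersLine
  simp only [Nat.choose_succ_self_right, Nat.cast_add, Nat.cast_one]
  rw [hs, hfloor]
  field_simp
  ring

/-- The value of the lower convex hull, the optimal load and the cut-set bound at one cache size. -/
lemma interpolatedLoad_spec {N r t : ℕ} {l : ℝ} (hr : 1 ≤ r) (hN : r + 1 ≤ N) (ht : t ≤ r + 1)
    (hl0 : 0 ≤ l) (hl1 : l < 1) (hl : t = r + 1 → l = 0) :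
    IsLeast {y : ℝ | ((t + l) * N / ((r : ℝ) + 1), y) ∈ convexHull ℝ
      {p : ℝ × ℝ | ∃ j : ℕ, j ≤ r + 1 ∧ p = ((j : ℝ) * N / ((r : ℝ) + 1), optimalLoad r j)}}
      (interpolatedLoad r t l) ∧
    IsOptimalUncodedLoad (r + 1) r N ((t + l) * N / ((r : ℝ) + 1)) (interpolatedLoad r t l) ∧
    IsCutSetBound (r + 1) r N ((t + l) * N / ((r : ℝ) + 1)) (interpolatedLoad r t l) := by
  have hN0 : 0 < N := by omega
  have hN' : (0 : ℝ) < N := by exact_mod_cast hN0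
  have hr' : (0 : ℝ) < r := by exact_mod_cast hr
  set M : ℝ := (t + l) * N / ((r : ℝ) + 1) with hM
  have hs : M * ((r : ℝ) + 1) / N = t + l := by rw [hM]; field_simp
  have htl : (t : ℝ) + l ≤ r + 1 := by
    rcases ht.eq_or_lt with h | h
    · rw [hl h, h]; push_cast; linarith
    · have : (t : ℝ) + 1 ≤ r + 1 := by exact_mod_cast h
      linarith
  have hM0 : 0 ≤ M := by positivity
  have hMN : M ≤ N := by
    rw [hM, div_le_iff₀ (by positivity)]
    nlinarith
  have hsingle : cutSetCurve N r r M = singleUserLine r (t + l) := by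
    rw [cutSetCurve_self hN0 hM0 hMN, singleUserLine, ← hs]
    field_simp
  have hall : cutSetCurve N r (r + 1) M = allUsersLine r t (t + l) :=
    cutSetCurve_succ hN0 hl0 hl1
  have hle1 := singleUserLine_le_interpolatedLoad hr ht hl0 hl1 hl
  have hle2 := allUsersLine_le_interpolatedLoad hr ht hl0 hl1 hl
  -- The interpolated load attains one of its two lower bounds; optimality, the hull value and the
  -- cut-set value all rest on this.
  have heq : interpolatedLoad r t l = singleUserLine r (t + l) ∨
      interpolatedLoad r t l = allUsersLine r t (t + l) :=
    (le_or_gt r (t + 1)).imp (fun h => interpolatedLoad_eq_singleUserLine h l)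
      fun h => interpolatedLoad_eq_allUsersLine h l
  have hchoose : (r + 1).choose r = r + 1 := Nat.choose_succ_self_right r
  refine ⟨⟨?_, ?_⟩, ⟨?_, ?_⟩, ?_, ?_⟩
  · have hmem : ∀ j : ℕ, j ≤ r + 1 → ((j : ℝ) * N / ((r : ℝ) + 1), optimalLoad r j) ∈
        convexHull ℝ {p : ℝ × ℝ | ∃ j : ℕ, j ≤ r + 1 ∧
          p = ((j : ℝ) * N / ((r : ℝ) + 1), optimalLoad r j)} :=
      fun j hj => subset_convexHull ℝ _ ⟨j, hj, rfl⟩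
    rcases ht.eq_or_lt with h | h
    · have := hmem t ht
      simpa [hM, interpolatedLoad, hl h] using this
    · have := (convex_convexHull ℝ {p : ℝ × ℝ | ∃ j : ℕ, j ≤ r + 1 ∧
        p = ((j : ℝ) * N / ((r : ℝ) + 1), optimalLoad r j)}) (hmem t ht) (hmem (t + 1) h)
        (sub_nonneg.2 hl1.le) hl0 (by ring)
      have heq : (1 - l) • ((t : ℝ) * N / ((r : ℝ) + 1), optimalLoad r t) +
          l • (((t + 1 : ℕ) : ℝ) * N / ((r : ℝ) + 1), optimalLoad r (t + 1)) =
          (M, interpolatedLoad r t l) := by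
        refine Prod.ext ?_ rfl
        simp only [Prod.fst_add, Prod.smul_fst, smul_eq_mul, hM]
        push_cast
        ring
      rw [heq] at this
      exact this
  · intro y hy
    -- The attained line supports the operating points: they lie in the half-plane above it, hence
    -- so does their convex hull.
    obtain ⟨α, γ, hv, hpts⟩ : ∃ α γ : ℝ, interpolatedLoad r t l = α - γ * (t + l) ∧
        ∀ j : ℕ, j ≤ r + 1 → α - γ * j ≤ optimalLoad r j := by
      rcases heq with h | h
      · refine ⟨1 / r, 1 / (((r : ℝ) + 1) * r), ?_, fun j hj => ?_⟩
        · rw [h, singleUserLine]; field_simp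
        · refine le_trans (le_of_eq ?_) (singleUserLine_le_optimalLoad hr hj)
          rw [singleUserLine]; field_simp
      · refine ⟨(((r : ℝ) + 2) * (2 * t + 2) / (((t : ℝ) + 1) * (t + 2)) - 1) / ((r : ℝ) + 1),
          ((r : ℝ) + 2) / (((t : ℝ) + 1) * (t + 2)) / ((r : ℝ) + 1), ?_, fun j hj => ?_⟩
        · rw [h, allUsersLine]; ring
        · refine le_trans (le_of_eq ?_) (allUsersLine_le_optimalLoad hr hj t)
          rw [allUsersLine]; ring
    have hconv : Convex ℝ {p : ℝ × ℝ | α ≤ p.2 + γ * (((r : ℝ) + 1) / N) * p.1} := by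
      refine convex_halfSpace_ge (f := fun p : ℝ × ℝ => p.2 + γ * (((r : ℝ) + 1) / N) * p.1)
        ⟨fun p q => ?_, fun c p => ?_⟩ α
      · simp only [Prod.fst_add, Prod.snd_add]; ring
      · simp only [Prod.smul_fst, Prod.smul_snd, smul_eq_mul]; ring
    have hsub := convexHull_min (s := {p : ℝ × ℝ | ∃ j : ℕ, j ≤ r + 1 ∧
        p = ((j : ℝ) * N / ((r : ℝ) + 1), optimalLoad r j)}) (by
      rintro p ⟨j, hj, rfl⟩
      have h1 : γ * (((r : ℝ) + 1) / N) * ((j : ℝ) * N / ((r : ℝ) + 1)) = γ * j := by field_simp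
      have h2 := hpts j hj
      simp only [Set.mem_ofPred_eq]
      rw [h1]
      linarith) hconv hy
    simp only [Set.mem_ofPred_eq] at hsub
    have h1 : γ * (((r : ℝ) + 1) / N) * M = γ * (t + l) := by rw [← hs]; ring
    rw [h1] at hsub
    rw [hv]
    linarith
  · intro R hR
    rcases heq with h | h
    · have hb := UncodedAchievable.single_user_bound hR (userOmitting 0)
      rw [h, singleUserLine, ← hs, div_le_iff₀ (by positivity)]
      have h2 : (r : ℝ) + 1 - M * ((r : ℝ) + 1) / N = ((N : ℝ) - M) * (((r : ℝ) + 1) / N) := by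
        field_simp
      have h3 : R * (((r : ℝ) + 1) * r) = N * (r * R) * (((r : ℝ) + 1) / N) := by field_simp
      rw [h2, h3]
      exact mul_le_mul_of_nonneg_right hb (by positivity)
    · have hb := UncodedAchievable.all_users_bound hR (by rw [hchoose]; exact hN) hN0 t
      rw [hchoose] at hb
      push_cast at hb
      rw [hs, show (r : ℝ) + 1 + 1 = r + 2 by ring] at hb
      rw [h, allUsersLine, div_le_iff₀ (by positivity), mul_comm R]
      exact hb
  · intro w hw
    -- The optimum is an infimum, so it suffices to achieve every load strictly above the
    -- interpolated one.
    refine le_of_forall_gt_imp_ge_of_dense fun R hR => hw ?_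
    have hnn : 0 ≤ interpolatedLoad r t l := by
      refine le_trans ?_ hle1
      exact div_nonneg (by linarith) (by positivity)
    have hscheme : ∀ j, j ≤ r + 1 → ∃ B : ℕ, 0 < B ∧ ZeroErrorScheme (r + 1) r N B
        ((j : ℝ) * N / ((r : ℝ) + 1) * B) (optimalLoad r j * B) := by
      intro j hj
      have := (schemeAchieves_optimalLoad N hr hj).zeroErrorScheme (by rw [hchoose]; exact hj)
      rw [hchoose] at this
      push_cast at this
      exact this
    obtain ⟨B, hB, h⟩ := hscheme t ht
    rcases ht.eq_or_lt with htr | htr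
    · have hl' := hl htr
      refine h.uncodedAchievable hB ?_ ?_ (hnn.trans hR.le)
      · rw [hM, hl', add_zero]
      · refine mul_le_mul_of_nonneg_right ?_ (Nat.cast_nonneg B)
        rw [interpolatedLoad, hl'] at hR
        linarith
    · obtain ⟨B', hB', h'⟩ := hscheme (t + 1) htr
      have := uncodedAchievable_of_lt hB hB' h h' (by push_cast; gcongr; linarith) hl0 hl1
        (hnn.trans hR.le) hR
      have hMeq : (1 - l) * ((t : ℝ) * N / ((r : ℝ) + 1)) +
          l * (((t + 1 : ℕ) : ℝ) * N / ((r : ℝ) + 1)) = M := by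
        rw [hM]; push_cast; ring
      rw [hMeq] at this
      exact this
  · rcases heq with h | h
    · exact ⟨r, ⟨le_rfl, Nat.le_succ r⟩, by rw [h]; exact hsingle⟩
    · exact ⟨r + 1, ⟨Nat.le_succ r, le_rfl⟩, by rw [h]; exact hall⟩
  · rintro _ ⟨x, ⟨hx1, hx2⟩, rfl⟩
    rcases hx1.eq_or_lt with rfl | hx
    · exact hsingle.le.trans hle1
    · obtain rfl : x = r + 1 := by omega
      exact hall.le.trans (hle2 t)

end CombNet

/-! ### The theorem. -/

theorem mainTheorem2 (H r N K : ℕ) (hr : 1 ≤ r) (hH : r + 1 = H) (hK : K = H.choose r)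
    (hN : K ≤ N) :
    ∃ ρ : ℕ → ℝ,
      -- the scheme works for each `t = 0, …, K`, with max-link load `ρ t`
      (∀ t : ℕ, t ≤ K → CombNet.SchemeAchieves H r N t (ρ t)) ∧
      (∀ t : ℕ, t + 2 ≤ K → ρ t = ((K : ℝ) - t) / (((t : ℝ) + 1) * H)) ∧
      ρ (K - 1) = 1 / ((r : ℝ) * K) ∧
      ρ K = 0 ∧
      -- it is optimal under uncoded placement and meets the cut-set bound
      (∀ t : ℕ, t ≤ K →
        CombNet.IsOptimalUncodedLoad H r N ((t : ℝ) * N / K) (ρ t) ∧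
        CombNet.IsCutSetBound H r N ((t : ℝ) * N / K) (ρ t)) ∧
      (∀ t : ℕ, t + 2 ≤ K → ρ t = CombNet.cutSetCurve N r H ((t : ℝ) * N / K)) ∧
      -- with memory sharing it is optimal for all cache sizes
      ∀ M : ℝ, 0 ≤ M → M ≤ N → ∃ v : ℝ,
        IsLeast {y : ℝ | (M, y) ∈ convexHull ℝ
          {p : ℝ × ℝ | ∃ t : ℕ, t ≤ K ∧ p = ((t : ℝ) * N / K, ρ t)}} v ∧
        CombNet.IsOptimalUncodedLoad H r N M v ∧
        CombNet.IsCutSetBound H r N M v := by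
  subst hH
  rw [Nat.choose_succ_self_right] at hK
  subst hK
  have hN0 : 0 < N := by omega
  have hN' : (0 : ℝ) < N := by exact_mod_cast hN0
  have hr' : (0 : ℝ) < r := by exact_mod_cast hr
  have hload : ∀ t : ℕ, t + 2 ≤ r + 1 →
      CombNet.optimalLoad r t = ((r : ℝ) + 1 - t) / (((t : ℝ) + 1) * (r + 1)) := fun t ht => by
    rw [CombNet.optimalLoad, min_eq_left (by omega), mul_comm ((r : ℝ) + 1)]
    push_cast
    rfl
  refine ⟨CombNet.optimalLoad r, fun t ht => CombNet.schemeAchieves_optimalLoad N hr ht, ?_, ?_, ?_,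
    ?_, ?_, ?_⟩
  · intro t ht
    push_cast
    exact hload t ht
  · rw [Nat.add_sub_cancel, CombNet.optimalLoad, min_eq_right (Nat.le_succ r)]
    push_cast
    rw [mul_comm ((r : ℝ) + 1)]
    congr 1
    ring
  · simp [CombNet.optimalLoad]
  · intro t ht
    have h := CombNet.interpolatedLoad_spec hr hN ht le_rfl zero_lt_one fun _ => rfl
    simp only [add_zero, CombNet.interpolatedLoad, sub_zero, one_mul, zero_mul] at h
    push_cast
    exact h.2
  · intro t ht
    have h := CombNet.cutSetCurve_succ (r := r) (t := t) hN0 le_rfl zero_lt_one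
    rw [add_zero] at h
    push_cast
    rw [h, hload t ht, CombNet.allUsersLine]
    field_simp
    ring
  · intro M hM0 hMN
    -- In units of `N / K` the cache size is `s`; its integer part selects the operating point and
    -- its fractional part is the memory-sharing weight.
    set s : ℝ := M * ((r : ℝ) + 1) / N with hs
    have hs0 : 0 ≤ s := by positivity
    have hs1 : s ≤ ((r + 1 : ℕ) : ℝ) := by
      rw [hs, div_le_iff₀ hN']
      push_cast
      nlinarith
    have h1 := Nat.floor_le hs0
    have h2 := Nat.lt_floor_add_one s
    have ht : ⌊s⌋₊ ≤ r + 1 := by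
      have := Nat.floor_le_floor hs1
      rwa [Nat.floor_natCast] at this
    have h := CombNet.interpolatedLoad_spec (l := s - ⌊s⌋₊) hr hN ht (by linarith) (by linarith)
      -- If the integer part is already `r + 1`, then `s ≤ r + 1` leaves no fractional part.
      fun h => by rw [h] at h1 ⊢; linarith
    have hM : ((⌊s⌋₊ : ℝ) + (s - ⌊s⌋₊)) * N / ((r : ℝ) + 1) = M := by
      rw [add_sub_cancel, hs]
      field_simp
    rw [hM] at h
    push_cast
    exact ⟨_, h⟩
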